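/- **Setting.** A *Delone $\kappa$-set* in $\mathbb R^d$ is a vector $\Lambda=(\Lambda_i)_{i\le\kappa}$ of pairwise disjoint Delone (uniformly discrete and relatively dense) subsets of $\mathbb R^d$ whose union $\mathrm{supp}(\Lambda)$ is Delone. The set of all Delone $\kappa$-sets carries the local rubber metric $\min\{\tilde d,2^{-1/2}\}$, where $\tilde d(\Gamma_1,\Gamma_2)$ is the infimum of all $\epsilon>0$ such that, colour by colour, $B_{1/\epsilon}(0)\cap\Gamma_2\subset\Gamma_1+B_\epsilon(0)$ and $B_{1/\epsilon}(0)\cap\Gamma_1\subset\Gamma_2+B_\epsilon(0)$. Let $\mathsf T_g\Gamma=\Gamma-g$, and let $X_\Lambda$ be the closure of $\{\mathsf T_g\Lambda:g\in\mathbb R^d\}$. $\Lambda$ is a *substitution Delone $\kappa$-set* if there are an expansive linear map $Q$ of $\mathbb R^d$ (that is, $\varrho(Qx,Qy)\ge c\,\varrho(x,y)$ for some $c>1$ and some metric $\varrho$ equivalent to the Euclidean one) and finite sets $\mathcal D_{ij}\subset\mathbb R^d$ with $\Lambda_i=\bigcup_{j}(Q\Lambda_j+\mathcal D_{ij})$ for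 all $i$, the sets $Q\Lambda_j+a$ ($j\le\kappa$, $a\in\mathcal D_{ij}$) being pairwise disjoint for each $i$. It is *primitive* if some power $\mathsf S^\ell$, $\ell>0$, of $\mathsf S=(\#\mathcal D_{ij})_{i,j}$ has no zero entry. It is *representable* if, for the family $(A_i)_{i\le\kappa}$ of non-empty compact sets that solves the adjoint system $QA_j=\bigcup_i(\mathcal D_{ij}+A_i)$, and with prototiles $T_i=(A_i,i)$, the set of tiles $\mathcal T=\{x+T_i:x\in\Lambda_i,\ i\le\kappa\}$ is a tiling of $\mathbb R^d$ (the supports of the tiles are compact, are closures of their interiors, and cover $\mathbb R^d$; distinct tiles have disjoint interiors). The tile-substitution is $\omega(x+T_j)=\{Qx+u+T_i:u\in\mathcal D_{ij},\ i\le\kappa\}$. A finite set $P$ of tiles is *legal* if it is a translate of a subset of $\omega^k(T_j)$ for some $k$ and $j$, and $\Xi_{\rm legal}(\Lambda)$ is the set of all $z\in\mathbb R^d$ for which some legal finite $P\subset\mathcal T$ contains two tiles $T$ and $T+z$. For $m\in\mathbb N$ divide $[-2^m,2^m)^d$ into the cubes $\prod_l[k_l2^{-m},(k_l+1)2^{-m})$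 with integers $-4^m\le k_l<4^m$, and let $\Delta_m$ be the set of pairs (cube, colour). Let $\Delta_{m,\alpha}$, $1\le\alpha\le N_m$, be the subsets of $\Delta_m$ that use each cube at most once. Let $U_{m,\alpha}$ be the family of finite coloured subsets of $[-2^m,2^m)^d$ that have, for each $(B,i)\in\Delta_{m,\alpha}$, exactly one point of colour $i$ in $B$, and, for each $(B,i)\in\Delta_m\setminus\Delta_{m,\alpha}$, no point of colour $i$ in $B$. The cylinder set is $X(U_{m,\alpha})=\{\Gamma\in X_\Lambda:\Gamma\cap[-2^m,2^m)^d\in U_{m,\alpha}\}$. Fix $m_0$ such that $2^{-m_0}<\eta/2$ for some $\eta>0$ for which every ball of radius $\eta/2$ contains at most one point of $\mathrm{supp}(\Lambda)$. **Lemma.** Let $\Lambda$ be a representable primitive substitution Delone $\kappa$-set with expansive map $Q$, and let $\mu$ be the translation-invariant Borel probability measure on $X_\Lambda$ (it is unique; the assertion is made for every such measure). For each $z\in\Xi_{\rm legal}(\Lambda)$ there is $\delta=\delta(z)>0$, independent of $(m,\alpha)$, such that for all $m\ge m_0$ and all $\alpha\in\{1,\dots,N_m\}$ with $\mu(X(U_{m,\alpha}))>0$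 there is $n(m,\alpha)$ such that, for all $n\ge n(m,\alpha)$, $$\mu\bigl(X(U_{m,\alpha})\cap\mathsf T_{-Q^nz}X(U_{m,\alpha})\bigr)>\delta\,\mu(X(U_{m,\alpha})).$$ -/

import Mathlib

open MeasureTheory Metric
open scoped Pointwise

noncomputable section

namespace SubstDelone

/-- The Euclidean space `ℝ^d`. -/
abbrev Euc (d : ℕ) := EuclideanSpace ℝ (Fin d)

/-- A vector of sets `(Λ_i)_{i ≤ κ}` in `ℝ^d`: the points of colour `i` are those of `Λ_i`. -/
abbrev ColouredSet (d κ : ℕ) := Fin κ → Set (Euc d)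

/-- A subset of `ℝ^d` is Delone if it is uniformly discrete and relatively dense. -/
def IsDelone {d : ℕ} (S : Set (Euc d)) : Prop :=
  ∃ D : Delone.DeloneSet (Euc d), D.carrier = S

/-- A Delone `κ`-set in `ℝ^d`: a coloured set in which no point carries two colours, each colour
class is Delone, and the union of the colour classes (the support) is Delone. -/
@[ext]
structure DeloneKSet (d κ : ℕ) where
  pts : ColouredSet d κ
  disjoint : ∀ i j, i ≠ j → Disjoint (pts i) (pts j)
  delone : ∀ i, IsDelone (pts i)
  delone_supp : IsDelone (⋃ i, pts i)

variable {d κ : ℕ}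

/-- The support of a Delone `κ`-set. -/
def DeloneKSet.supp (Γ : DeloneKSet d κ) : Set (Euc d) := ⋃ i, Γ.pts i

/-! The local rubber metric on the set of all Delone `κ`-sets. -/

/-- The condition `B_{1/ε}(0) ∩ Γ₂ ⊆ Γ₁ + B_ε(0)` and `B_{1/ε}(0) ∩ Γ₁ ⊆ Γ₂ + B_ε(0)`,
colour by colour. -/
def Close (ε : ℝ) (Γ₁ Γ₂ : ColouredSet d κ) : Prop :=
  ∀ i, ball 0 (1 / ε) ∩ Γ₂ i ⊆ Γ₁ i + ball 0 ε ∧ ball 0 (1 / ε) ∩ Γ₁ i ⊆ Γ₂ i + ball 0 ε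

/-- `d̃(Γ₁, Γ₂)`, the infimum of all `ε > 0` for which `Γ₁` and `Γ₂` are `ε`-close. -/
def rubberDistAux (Γ₁ Γ₂ : DeloneKSet d κ) : ℝ :=
  sInf {ε : ℝ | 0 < ε ∧ Close ε Γ₁.pts Γ₂.pts}

/-- The local rubber metric `min {d̃, 2^{-1/2}}`. -/
def rubberDist (Γ₁ Γ₂ : DeloneKSet d κ) : ℝ :=
  min (rubberDistAux Γ₁ Γ₂) ((2 : ℝ) ^ (-(1 / 2) : ℝ))

theorem close_iff {ε : ℝ} {Γ₁ Γ₂ : ColouredSet d κ} :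
    Close ε Γ₁ Γ₂ ↔ ∀ i, (∀ x ∈ Γ₂ i, ‖x‖ < 1 / ε → ∃ y ∈ Γ₁ i, dist x y < ε) ∧
      (∀ x ∈ Γ₁ i, ‖x‖ < 1 / ε → ∃ y ∈ Γ₂ i, dist x y < ε) := by
  have key : ∀ S T : Set (Euc d), (ball 0 (1 / ε) ∩ S ⊆ T + ball 0 ε) ↔
      ∀ x ∈ S, ‖x‖ < 1 / ε → ∃ y ∈ T, dist x y < ε := by
    intro S T
    constructor
    · intro h x hx hn
      obtain ⟨y, hy, b, hb, hyb⟩ := h ⟨by simpa using hn, hx⟩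
      refine ⟨y, hy, ?_⟩
      rw [← hyb, dist_eq_norm]
      simpa using hb
    · rintro h x ⟨hx, hxS⟩
      obtain ⟨y, hy, hd⟩ := h x hxS (by simpa using hx)
      refine ⟨y, hy, x - y, ?_, by simp⟩
      rw [dist_eq_norm] at hd
      simpa using hd
  simp only [Close, key]

theorem Close.symm {ε : ℝ} {Γ₁ Γ₂ : ColouredSet d κ} (h : Close ε Γ₁ Γ₂) : Close ε Γ₂ Γ₁ :=
  fun i => ⟨(h i).2, (h i).1⟩

theorem Close.mono {ε ε' : ℝ} {Γ₁ Γ₂ : ColouredSet d κ} (hε : 0 < ε) (hle : ε ≤ ε')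
    (h : Close ε Γ₁ Γ₂) : Close ε' Γ₁ Γ₂ := by
  rw [close_iff] at *
  have h1 : 1 / ε' ≤ 1 / ε := one_div_le_one_div_of_le hε hle
  intro i
  refine ⟨fun x hx hn => ?_, fun x hx hn => ?_⟩
  · obtain ⟨y, hy, hd⟩ := (h i).1 x hx (hn.trans_le h1)
    exact ⟨y, hy, hd.trans_le hle⟩
  · obtain ⟨y, hy, hd⟩ := (h i).2 x hx (hn.trans_le h1)
    exact ⟨y, hy, hd.trans_le hle⟩

theorem Close.trans {ε₁ ε₂ : ℝ} {Γ₁ Γ₂ Γ₃ : ColouredSet d κ} (h1 : 0 < ε₁) (h2 : 0 < ε₂)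
    (hle : ε₁ + ε₂ ≤ 1) (h12 : Close ε₁ Γ₁ Γ₂) (h23 : Close ε₂ Γ₂ Γ₃) :
    Close (ε₁ + ε₂) Γ₁ Γ₃ := by
  have key : ∀ a b : ℝ, 0 < a → 0 < b → a + b ≤ 1 → 1 / (a + b) + b ≤ 1 / a := by
    intro a b ha hb hab
    rw [div_add' _ _ _ (by positivity), div_le_div_iff₀ (by positivity) ha]
    nlinarith [mul_pos ha hb]
  have aux : ∀ (S T U : Set (Euc d)) (a b : ℝ), 0 < a → 0 < b → a + b ≤ 1 →
      (∀ x ∈ S, ‖x‖ < 1 / b → ∃ y ∈ T, dist x y < b) →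
      (∀ x ∈ T, ‖x‖ < 1 / a → ∃ y ∈ U, dist x y < a) →
      ∀ x ∈ S, ‖x‖ < 1 / (a + b) → ∃ y ∈ U, dist x y < a + b := by
    intro S T U a b ha hb hab hST hTU x hx hn
    obtain ⟨y, hy, hxy⟩ := hST x hx (hn.trans_le (one_div_le_one_div_of_le hb (by linarith)))
    have hy' : ‖y‖ ≤ ‖x‖ + dist x y := by
      rw [dist_eq_norm]
      have := norm_sub_norm_le y x
      rw [norm_sub_rev] at this
      linarith
    obtain ⟨u, hu, hyu⟩ := hTU y hy (by linarith [key a b ha hb hab])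
    exact ⟨u, hu, by linarith [dist_triangle x y u]⟩
  rw [close_iff] at *
  intro i
  refine ⟨aux _ _ _ _ _ h1 h2 hle (h23 i).1 (h12 i).1, ?_⟩
  have := aux _ _ _ _ _ h2 h1 (by linarith) (h12 i).2 (h23 i).2
  rwa [add_comm ε₂ ε₁] at this

theorem exists_close (Γ₁ Γ₂ : DeloneKSet d κ) :
    {ε : ℝ | 0 < ε ∧ Close ε Γ₁.pts Γ₂.pts}.Nonempty := by
  choose D₁ hD₁ using Γ₁.delone
  choose D₂ hD₂ using Γ₂.delone
  obtain ⟨M₁, hM₁⟩ := Finite.exists_le fun i => ((D₁ i).coveringRadius : ℝ)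
  obtain ⟨M₂, hM₂⟩ := Finite.exists_le fun i => ((D₂ i).coveringRadius : ℝ)
  refine ⟨max 0 (max M₁ M₂) + 1, by positivity, close_iff.2 fun i => ⟨fun x _ _ => ?_, fun x _ _ => ?_⟩⟩
  · obtain ⟨y, hy, hd⟩ := (D₁ i).exists_dist_le_coveringRadius x
    refine ⟨y, hD₁ i ▸ hy, ?_⟩
    have := le_max_right 0 (max M₁ M₂)
    linarith [hM₁ i, le_max_left M₁ M₂]
  · obtain ⟨y, hy, hd⟩ := (D₂ i).exists_dist_le_coveringRadius x
    refine ⟨y, hD₂ i ▸ hy, ?_⟩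
    have := le_max_right 0 (max M₁ M₂)
    linarith [hM₂ i, le_max_right M₁ M₂]

theorem rubberDistAux_nonneg (Γ₁ Γ₂ : DeloneKSet d κ) : 0 ≤ rubberDistAux Γ₁ Γ₂ :=
  Real.sInf_nonneg fun _ h => h.1.le

theorem close_of_rubberDistAux_lt {ε : ℝ} {Γ₁ Γ₂ : DeloneKSet d κ}
    (h : rubberDistAux Γ₁ Γ₂ < ε) : Close ε Γ₁.pts Γ₂.pts := by
  obtain ⟨e, ⟨he, hc⟩, hlt⟩ := exists_lt_of_csInf_lt (exists_close Γ₁ Γ₂) h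
  exact hc.mono he hlt.le

theorem rubberDistAux_le {ε : ℝ} {Γ₁ Γ₂ : DeloneKSet d κ} (hε : 0 < ε)
    (h : Close ε Γ₁.pts Γ₂.pts) : rubberDistAux Γ₁ Γ₂ ≤ ε :=
  csInf_le ⟨0, fun _ h => h.1.le⟩ ⟨hε, h⟩

theorem cap_pos : (0 : ℝ) < (2 : ℝ) ^ (-(1 / 2) : ℝ) := by positivity

theorem cap_le_one : (2 : ℝ) ^ (-(1 / 2) : ℝ) ≤ 1 :=
  Real.rpow_le_one_of_one_le_of_nonpos (by norm_num) (by norm_num)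

theorem rubberDist_self (Γ : DeloneKSet d κ) : rubberDist Γ Γ = 0 := by
  have h : rubberDistAux Γ Γ = 0 := by
    refine le_antisymm (le_of_forall_pos_le_add fun ε hε => ?_) (rubberDistAux_nonneg _ _)
    rw [zero_add]
    refine rubberDistAux_le hε (close_iff.2 fun i => ?_)
    exact ⟨fun x hx _ => ⟨x, hx, by simpa⟩, fun x hx _ => ⟨x, hx, by simpa⟩⟩
  rw [rubberDist, h, min_eq_left cap_pos.le]

theorem rubberDist_comm (Γ₁ Γ₂ : DeloneKSet d κ) : rubberDist Γ₁ Γ₂ = rubberDist Γ₂ Γ₁ := by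
  have : {ε : ℝ | 0 < ε ∧ Close ε Γ₁.pts Γ₂.pts} = {ε : ℝ | 0 < ε ∧ Close ε Γ₂.pts Γ₁.pts} := by
    ext ε
    exact ⟨fun h => ⟨h.1, h.2.symm⟩, fun h => ⟨h.1, h.2.symm⟩⟩
  rw [rubberDist, rubberDist, rubberDistAux, rubberDistAux, this]

theorem rubberDist_triangle (Γ₁ Γ₂ Γ₃ : DeloneKSet d κ) :
    rubberDist Γ₁ Γ₃ ≤ rubberDist Γ₁ Γ₂ + rubberDist Γ₂ Γ₃ := by
  have n12 := rubberDistAux_nonneg Γ₁ Γ₂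
  have n23 := rubberDistAux_nonneg Γ₂ Γ₃
  have hc := cap_pos
  have hc1 := cap_le_one
  unfold rubberDist
  set c := (2 : ℝ) ^ (-(1 / 2) : ℝ)
  by_cases h : rubberDistAux Γ₁ Γ₂ + rubberDistAux Γ₂ Γ₃ < c
  · rw [min_eq_left (by linarith : rubberDistAux Γ₁ Γ₂ ≤ c),
      min_eq_left (by linarith : rubberDistAux Γ₂ Γ₃ ≤ c)]
    refine (min_le_left _ _).trans (le_of_forall_pos_le_add fun ε hε => ?_)
    set η := min ε (c - (rubberDistAux Γ₁ Γ₂ + rubberDistAux Γ₂ Γ₃))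
    have hη : 0 < η := lt_min hε (by linarith)
    have hη1 : η ≤ ε := min_le_left _ _
    have hη2 : η ≤ c - (rubberDistAux Γ₁ Γ₂ + rubberDistAux Γ₂ Γ₃) := min_le_right _ _
    have h12 := close_of_rubberDistAux_lt (show rubberDistAux Γ₁ Γ₂ < rubberDistAux Γ₁ Γ₂ + η / 2 by linarith)
    have h23 := close_of_rubberDistAux_lt (show rubberDistAux Γ₂ Γ₃ < rubberDistAux Γ₂ Γ₃ + η / 2 by linarith)
    have := rubberDistAux_le (by linarith)
      (h12.trans (by linarith) (by linarith) (by linarith) h23)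
    linarith
  · push Not at h
    refine (min_le_right _ _).trans ?_
    rcases le_total (rubberDistAux Γ₁ Γ₂) c with a | a
    · rcases le_total (rubberDistAux Γ₂ Γ₃) c with b | b
      · rw [min_eq_left a, min_eq_left b]; exact h
      · rw [min_eq_left a, min_eq_right b]; linarith
    · rw [min_eq_right a]
      linarith [le_min n23 hc.le]

theorem subset_of_close {S T : Set (Euc d)} (hT : IsDelone T)
    (h : ∀ ε : ℝ, 0 < ε → ∀ x ∈ S, ‖x‖ < 1 / ε → ∃ y ∈ T, dist x y < ε) : S ⊆ T := by
  obtain ⟨D, rfl⟩ := hT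
  intro x hx
  have hr : (0 : ℝ) < D.packingRadius := D.packingRadius_pos
  have h' : ∀ ε : ℝ, 0 < ε → ∃ y ∈ D, dist x y < ε := by
    intro ε hε
    have hn : 0 < 1 / (‖x‖ + 1) := by positivity
    obtain ⟨y, hy, hd⟩ := h (min ε (1 / (‖x‖ + 1))) (lt_min hε hn) x hx <| by
      have h1 : ‖x‖ + 1 ≤ 1 / min ε (1 / (‖x‖ + 1)) := by
        rw [le_one_div (by positivity) (lt_min hε hn)]
        exact min_le_right _ _
      linarith
    exact ⟨y, hy, hd.trans_le (min_le_left _ _)⟩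
  obtain ⟨y, hy, hxy⟩ := h' _ (half_pos hr)
  by_contra hxD
  have hne : x ≠ y := fun e => hxD (e ▸ hy)
  obtain ⟨y', hy', hxy'⟩ := h' _ (lt_min (half_pos hr) (dist_pos.2 hne))
  have hne' : y ≠ y' := by
    rintro rfl
    exact absurd (hxy'.trans_le (min_le_right _ _)) (lt_irrefl _)
  have h1 := D.packingRadius_lt_dist_of_mem_ne hy hy' hne'
  have h2 := dist_triangle_left y y' x
  have h3 := hxy'.trans_le (min_le_left _ _)
  linarith

theorem eq_of_rubberDist_eq_zero {Γ₁ Γ₂ : DeloneKSet d κ} (h : rubberDist Γ₁ Γ₂ = 0) :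
    Γ₁ = Γ₂ := by
  have h0 : rubberDistAux Γ₁ Γ₂ = 0 := by
    rcases min_choice (rubberDistAux Γ₁ Γ₂) ((2 : ℝ) ^ (-(1 / 2) : ℝ)) with e | e
    · rw [← e]; exact h
    · exact absurd (e.symm.trans h) cap_pos.ne'
  have hc : ∀ ε : ℝ, 0 < ε → Close ε Γ₁.pts Γ₂.pts := fun ε hε =>
    close_of_rubberDistAux_lt (h0 ▸ hε)
  ext1
  funext i
  refine Set.Subset.antisymm (subset_of_close (Γ₂.delone i) fun ε hε => ?_)
    (subset_of_close (Γ₁.delone i) fun ε hε => ?_)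
  · exact (close_iff.1 (hc ε hε) i).2
  · exact (close_iff.1 (hc ε hε) i).1

instance : MetricSpace (DeloneKSet d κ) where
  dist := rubberDist
  dist_self := rubberDist_self
  dist_comm := rubberDist_comm
  dist_triangle := rubberDist_triangle
  eq_of_dist_eq_zero := eq_of_rubberDist_eq_zero

/-- The Borel `σ`-algebra. -/
instance : MeasurableSpace (DeloneKSet d κ) := borel _

instance : BorelSpace (DeloneKSet d κ) := ⟨rfl⟩

/-! The translation action and the orbit closure. -/

theorem IsDelone.translate {S : Set (Euc d)} (h : IsDelone S) (g : Euc d) :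
    IsDelone {x | x + g ∈ S} := by
  obtain ⟨D, rfl⟩ := h
  refine ⟨Delone.DeloneSet.mapIsometry (IsometryEquiv.addRight (-g)) D, ?_⟩
  change (fun a => a + -g) '' D.carrier = {x | x + g ∈ D.carrier}
  ext x
  simp only [Set.mem_image, Set.mem_ofPred_eq]
  constructor
  · rintro ⟨a, ha, rfl⟩
    simpa using ha
  · intro hx
    exact ⟨x + g, hx, by simp⟩

/-- The translation `T_g : Γ ↦ Γ - g`. -/
def translate (g : Euc d) (Γ : DeloneKSet d κ) : DeloneKSet d κ where
  pts i := {x | x + g ∈ Γ.pts i}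
  disjoint i j hij := Set.disjoint_left.2 fun _ hx hy =>
    Set.disjoint_left.1 (Γ.disjoint i j hij) hx hy
  delone i := (Γ.delone i).translate g
  delone_supp := by
    have h := Γ.delone_supp.translate g
    have e : {x | x + g ∈ ⋃ i, Γ.pts i} = ⋃ i, {x | x + g ∈ Γ.pts i} := by
      ext x
      simp
    rwa [e] at h

theorem translate_translate (g h : Euc d) (Γ : DeloneKSet d κ) :
    translate g (translate h Γ) = translate (g + h) Γ := by
  ext i x
  simp [translate, add_assoc]

theorem continuous_translate (g : Euc d) :
    Continuous (translate g : DeloneKSet d κ → DeloneKSet d κ) := by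
  rw [Metric.continuous_iff]
  intro Γ ε hε
  have he : 0 < ε / 2 := half_pos hε
  have hpos : 0 < 1 / (ε / 2) + ‖g‖ := by positivity
  set δ : ℝ := 1 / (1 / (ε / 2) + ‖g‖) with hδ
  have hδpos : 0 < δ := one_div_pos.2 hpos
  have hδinv : 1 / δ = 1 / (ε / 2) + ‖g‖ := by rw [hδ, one_div_one_div]
  have hδle : δ ≤ ε / 2 := by
    rw [hδ, one_div_le hpos he]
    linarith [norm_nonneg g]
  refine ⟨min δ ((2 : ℝ) ^ (-(1 / 2) : ℝ)), lt_min hδpos cap_pos, fun Γ' h => ?_⟩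
  have h1 : rubberDistAux Γ' Γ < δ := by
    by_contra hcon
    push Not at hcon
    exact absurd h (not_lt.2 (min_le_min_right _ hcon))
  have hc := close_iff.1 (close_of_rubberDistAux_lt h1)
  have aux : ∀ S T : Set (Euc d), (∀ x ∈ S, ‖x‖ < 1 / δ → ∃ y ∈ T, dist x y < δ) →
      ∀ x, x + g ∈ S → ‖x‖ < 1 / (ε / 2) → ∃ y, y + g ∈ T ∧ dist x y < ε / 2 := by
    intro S T hST x hx hn
    obtain ⟨y, hy, hd⟩ := hST (x + g) hx (by
      rw [hδinv]
      linarith [norm_add_le x g])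
    refine ⟨y - g, by simpa using hy, lt_of_eq_of_lt ?_ (hd.trans_le hδle)⟩
    rw [dist_eq_norm, dist_eq_norm]
    congr 1
    abel
  have h2 : Close (ε / 2) (translate g Γ').pts (translate g Γ).pts :=
    close_iff.2 fun i => ⟨aux _ _ (hc i).1, aux _ _ (hc i).2⟩
  have h3 : rubberDist (translate g Γ') (translate g Γ) ≤ ε / 2 :=
    (min_le_left _ _).trans (rubberDistAux_le he h2)
  exact h3.trans_lt (half_lt_self hε)

/-- The orbit closure `X_Λ` of `Λ` under translations. -/
def hull (Λ : DeloneKSet d κ) : Set (DeloneKSet d κ) :=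
  closure (Set.range fun g => translate g Λ)

theorem translate_mem_hull (Λ : DeloneKSet d κ) (g : Euc d) {Γ : DeloneKSet d κ}
    (h : Γ ∈ hull Λ) : translate g Γ ∈ hull Λ := by
  refine map_mem_closure (continuous_translate g) h ?_
  rintro _ ⟨a, rfl⟩
  exact ⟨g + a, (translate_translate g a Λ).symm⟩

/-- The translation `T_g : Γ ↦ Γ - g` on `X_Λ`. -/
def hullTranslate (Λ : DeloneKSet d κ) (g : Euc d) (Γ : hull Λ) : hull Λ :=
  ⟨translate g Γ, translate_mem_hull Λ g Γ.2⟩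

/-! Cylinder sets. -/

/-- The grid cube `∏_l [k_l / 2^m, (k_l + 1) / 2^m)`. -/
def gridCube (m : ℕ) (k : Fin d → ℤ) : Set (Euc d) :=
  {x | ∀ l, (k l : ℝ) / 2 ^ m ≤ x l ∧ x l < ((k l : ℝ) + 1) / 2 ^ m}

/-- The window `[-2^m, 2^m)^d`. -/
def window (d m : ℕ) : Set (Euc d) :=
  {x | ∀ l, -(2 : ℝ) ^ m ≤ x l ∧ x l < 2 ^ m}

/-- `Δ_m`: all coloured grid cubes of side length `2^{-m}` in the window `[-2^m, 2^m)^d`. A coloured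
cube is a pair of the index `k` of a cube and a colour. -/
def colouredCubes (d κ m : ℕ) : Set ((Fin d → ℤ) × Fin κ) :=
  {C | ∀ l, -(4 : ℤ) ^ m ≤ C.1 l ∧ C.1 l < 4 ^ m}

/-- The sets `Δ_{m,α}`: subsets of `Δ_m` in which each cube is chosen at most once. -/
def IsCubeChoice (m : ℕ) (Δ : Set ((Fin d → ℤ) × Fin κ)) : Prop :=
  Δ ⊆ colouredCubes d κ m ∧
    ∀ C₁ ∈ Δ, ∀ C₂ ∈ Δ, C₁ ≠ C₂ → gridCube m C₁.1 ∩ gridCube m C₂.1 = ∅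

/-- `U_{m,α}` for `Δ = Δ_{m,α}`: the finite coloured subsets of the window that have exactly one
point of the right colour in each coloured cube of `Δ`, and no point in the other coloured cubes. -/
def patterns (m : ℕ) (Δ : Set ((Fin d → ℤ) × Fin κ)) : Set (ColouredSet d κ) :=
  {P | (∀ i, P i ⊆ window d m) ∧ (∀ i, (P i).Finite) ∧
    (∀ C ∈ Δ, ∃ p, P C.2 ∩ gridCube m C.1 = {p}) ∧
    ∀ C ∈ colouredCubes d κ m \ Δ, P C.2 ∩ gridCube m C.1 = ∅}

/-- The cylinder set `X(U_{m,α}) = {Γ ∈ X_Λ : Γ ∩ [-2^m, 2^m)^d ∈ U_{m,α}}`. -/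
def gridCylinder (Λ : DeloneKSet d κ) (m : ℕ) (Δ : Set ((Fin d → ℤ) × Fin κ)) : Set (hull Λ) :=
  {Γ | (fun i => Γ.1.pts i ∩ window d m) ∈ patterns m Δ}

/-- `m₀` is admissible for `Λ`: for some `η > 0` every ball of radius `η/2` contains at most one
point of the support of `Λ`, and `1/2^{m₀} < η/2`. -/
def IsAdmissibleScale (Λ : DeloneKSet d κ) (m₀ : ℕ) : Prop :=
  ∃ η : ℝ, 0 < η ∧ (∀ x, (Λ.supp ∩ ball x (η / 2)).Subsingleton) ∧ 1 / (2 : ℝ) ^ m₀ < η / 2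

/-! Substitution Delone `κ`-sets and their tilings. -/

/-- A linear map is expansive if, for some `c > 1` and some metric `ρ` equivalent to the Euclidean
one, `ρ (Q x) (Q y) ≥ c ρ x y` for all `x`, `y`. -/
def IsExpansive (Q : Euc d →ₗ[ℝ] Euc d) : Prop :=
  ∃ (ρ : MetricSpace (Euc d)) (c : ℝ), 1 < c ∧
    (∃ a b : ℝ, 0 < a ∧ 0 < b ∧
      ∀ x y, a * dist x y ≤ ρ.dist x y ∧ ρ.dist x y ≤ b * dist x y) ∧
    ∀ x y, c * ρ.dist x y ≤ ρ.dist (Q x) (Q y)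

/-- `Λ` is a substitution Delone `κ`-set with expansive map `Q` and finite sets `D i j`:
`Λ_i = ⋃_j (Q Λ_j + D i j)`, where the unions are disjoint. -/
structure IsSubstitution (Q : Euc d →ₗ[ℝ] Euc d) (D : Fin κ → Fin κ → Finset (Euc d))
    (Λ : DeloneKSet d κ) : Prop where
  expansive : IsExpansive Q
  eq_iUnion : ∀ i, Λ.pts i = ⋃ j, (Q '' Λ.pts j + (D i j : Set (Euc d)))
  disjoint : ∀ i j j', ∀ a ∈ D i j, ∀ a' ∈ D i j', (j, a) ≠ (j', a') →
    Disjoint (Q '' Λ.pts j + {a}) (Q '' Λ.pts j' + {a'})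

/-- The substitution matrix `S i j = #(D i j)`. -/
def substMatrix (D : Fin κ → Fin κ → Finset (Euc d)) : Matrix (Fin κ) (Fin κ) ℕ :=
  Matrix.of fun i j => (D i j).card

/-- Primitivity: some power `S ^ l`, `l > 0`, has no zero entry. -/
def IsPrimitive (D : Fin κ → Fin κ → Finset (Euc d)) : Prop :=
  ∃ l : ℕ, 0 < l ∧ ∀ i j, (substMatrix D ^ l) i j ≠ 0

/-- `(A_j)` is the family of non-empty compact sets that solves the adjoint system
`Q A_j = ⋃_i (D i j + A_i)`. -/
structure IsAdjointSolution (Q : Euc d →ₗ[ℝ] Euc d) (D : Fin κ → Fin κ → Finset (Euc d))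
    (A : Fin κ → Set (Euc d)) : Prop where
  nonempty : ∀ j, (A j).Nonempty
  isCompact : ∀ j, IsCompact (A j)
  image_eq : ∀ j, Q '' A j = ⋃ i, ((D i j : Set (Euc d)) + A i)

/-- A (coloured) tile: its support together with its type. -/
abbrev Tile (d κ : ℕ) := Set (Euc d) × Fin κ

/-- The translate `x + T` of a tile. -/
def Tile.shift (x : Euc d) (T : Tile d κ) : Tile d κ := (x +ᵥ T.1, T.2)

/-- The prototile `T_i = (A_i, i)`. -/
def prototile (A : Fin κ → Set (Euc d)) (i : Fin κ) : Tile d κ := (A i, i)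

/-- A set of tiles is a tiling if its tiles are compact and the closure of their interior, cover
`ℝ^d`, and distinct tiles have disjoint interiors. -/
structure IsTiling (𝒯 : Set (Tile d κ)) : Prop where
  isCompact : ∀ T ∈ 𝒯, IsCompact T.1
  closure_interior : ∀ T ∈ 𝒯, closure (interior T.1) = T.1
  covers : ⋃ T ∈ 𝒯, T.1 = Set.univ
  disjoint : ∀ T ∈ 𝒯, ∀ T' ∈ 𝒯, T ≠ T' → Disjoint (interior T.1) (interior T'.1)

/-- The set of tiles `Λ + 𝒜 = {x + T_i : x ∈ Λ_i, i ≤ κ}`. -/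
def tiles (Λ : DeloneKSet d κ) (A : Fin κ → Set (Euc d)) : Set (Tile d κ) :=
  {T | ∃ i, ∃ x ∈ Λ.pts i, T = Tile.shift x (prototile A i)}

/-- `Λ` is representable, and `A` is the family of supports of the prototiles: `A` solves the
adjoint system and `Λ + 𝒜` is a tiling. -/
structure IsRepresentedBy (Q : Euc d →ₗ[ℝ] Euc d) (D : Fin κ → Fin κ → Finset (Euc d))
    (Λ : DeloneKSet d κ) (A : Fin κ → Set (Euc d)) : Prop where
  adjoint : IsAdjointSolution Q D A
  tiling : IsTiling (tiles Λ A)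

/-- The tile-substitution `ω`, extended to sets of tiles:
`ω(x + T_j) = {Q x + u + T_i : u ∈ D i j, i ≤ κ}`. -/
def tileSubst (Q : Euc d →ₗ[ℝ] Euc d) (D : Fin κ → Fin κ → Finset (Euc d))
    (A : Fin κ → Set (Euc d)) (P : Set (Tile d κ)) : Set (Tile d κ) :=
  {T | ∃ j x, Tile.shift x (prototile A j) ∈ P ∧
    ∃ i, ∃ u ∈ D i j, T = Tile.shift (Q x + u) (prototile A i)}

/-- A patch is legal if it is a translate of a subpatch of `ω^k(T_j)` for some `k` and `j`. -/
def IsLegal (Q : Euc d →ₗ[ℝ] Euc d) (D : Fin κ → Fin κ → Finset (Euc d))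
    (A : Fin κ → Set (Euc d)) (P : Set (Tile d κ)) : Prop :=
  ∃ (k : ℕ) (j : Fin κ) (v : Euc d),
    Tile.shift v '' P ⊆ (tileSubst Q D A)^[k] {prototile A j}

/-- `Ξ_legal(Λ)`: the vectors `z` such that some legal patch of the tiling `Λ + 𝒜` contains two
tiles `T` and `T + z`. -/
def legalReturnVectors (Q : Euc d →ₗ[ℝ] Euc d) (D : Fin κ → Fin κ → Finset (Euc d))
    (Λ : DeloneKSet d κ) (A : Fin κ → Set (Euc d)) : Set (Euc d) :=
  {z | ∃ P ⊆ tiles Λ A, P.Finite ∧ IsLegal Q D A P ∧ ∃ T ∈ P, ∃ T' ∈ P, T' = Tile.shift z T}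

end SubstDelone

end

open SubstDelone

namespace SubstDelone

open Filter Topology

variable {d κ : ℕ}

/-! ### Topology of the space of Delone `κ`-sets -/

/-! Legality of `z` yields k, i, j, u with both u and u + z in the iterated digit set D^(k)_ij.
Hence for every n, each supertile of level n + k and type j contains two supertiles of level n and
type i that differ by the translation Q^n z, and a pattern seen well inside the first is seen again
in the second, Q^n z further on. Returns of a cylinder E by Q^n z are therefore at least as
frequent, up to a constant, as occurrences of E inside supertiles of level n and type i; by
primitivity these make up a fixed proportion of all occurrences.

Frequencies are compared with μ without an ergodic theorem or unique ergodicity. By Fubini and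
invariance, μ(G) vol(W) is the μ-average of the time that Γ - f(s), s ∈ W, spends in G. For open G
this time is bounded by its supremum along the orbit of Λ, by lower semicontinuity
(`measure_mul_volume_le`). Cylinders have null frontier (`measure_frontier_gridCylinder`), so the
bound applied to the interior of E estimates μ(E) from above, and applied to the complement of the
closure of the return set it estimates the return set from below.

All regions are scaled back by Q^n: W is a fixed ball of radius r, large enough to hold a tile of
every type around any centre, and V is its volume. Let X be the volume of the part of A_i at which
supertiles of level n + l show E away from their boundary. Then `exists_volume_le_sum` and
`volume_coreVisits_le` give μ(E) V ≤ N (κ |det Q^l| X + Err_n), and `volume_setOf_not_return_le`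
gives at least |det Q^k|⁻¹ X for the measure of the returns by Q^(n+l) z, times V. The error Err_n
is the volume of collars of the prototile boundaries, of width shrinking with n; it tends to 0
because those boundaries are null (`volume_tilesBoundary`). The cylinder enters the constants only
through the margin ρ of the collars, so it affects the threshold for n but not δ. -/

theorem IsDelone.exists_le_dist {S : Set (Euc d)} (h : IsDelone S) :
    ∃ r : ℝ, 0 < r ∧ S.Pairwise fun x y => r ≤ dist x y := by
  obtain ⟨D, rfl⟩ := h
  exact ⟨D.packingRadius, D.packingRadius_pos,
    fun x hx y hy hne => (D.packingRadius_lt_dist_of_mem_ne hx hy hne).le⟩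

theorem IsDelone.exists_dist_le {S : Set (Euc d)} (h : IsDelone S) :
    ∃ R : ℝ, 0 < R ∧ ∀ x, ∃ y ∈ S, dist x y ≤ R := by
  obtain ⟨D, rfl⟩ := h
  exact ⟨D.coveringRadius, D.coveringRadius_pos, fun x => D.exists_dist_le_coveringRadius x⟩

theorem IsDelone.isClosed {S : Set (Euc d)} (h : IsDelone S) : IsClosed S := by
  obtain ⟨r, hr, hS⟩ := h.exists_le_dist
  exact Metric.isClosed_of_pairwise_le_dist hr hS

/-- A separated set has boundedly many points in balls of a given radius. -/
theorem exists_card_le_of_pairwise_le_dist {S : Set (Euc d)} {r : ℝ} (hr : 0 < r)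
    (hS : S.Pairwise fun x y => r ≤ dist x y) (R : ℝ) :
    ∃ N : ℕ, ∀ h, (S ∩ closedBall h R).Finite ∧ (S ∩ closedBall h R).ncard ≤ N := by
  -- One cover of the ball about 0 is translated to every h, so its size bounds the count uniformly;
  -- a ball of radius r/2 holds at most one point of S.
  obtain ⟨t, -, ht, hcov⟩ := (isCompact_closedBall (0 : Euc d) R).finite_cover_balls (half_pos hr)
  refine ⟨t.ncard, fun h => ?_⟩
  have key : ∀ x, ∃ c, x ∈ S ∩ closedBall h R → c ∈ t ∧ dist (x - h) c < r / 2 := by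
    intro x
    by_cases hx : x ∈ S ∩ closedBall h R
    · have hmem : x - h ∈ closedBall (0 : Euc d) R := by
        simpa [dist_eq_norm] using hx.2
      obtain ⟨c, hc, hxc⟩ := Set.mem_iUnion₂.1 (hcov hmem)
      exact ⟨c, fun _ => ⟨hc, hxc⟩⟩
    · exact ⟨0, fun h' => absurd h' hx⟩
  choose f hf using key
  have hmaps : Set.MapsTo f (S ∩ closedBall h R) t := fun x hx => (hf x hx).1
  have hinj : Set.InjOn f (S ∩ closedBall h R) := by
    intro x hx y hy hxy
    by_contra hne
    have h1 := (hf x hx).2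
    have h2 := (hf y hy).2
    have h3 := dist_triangle_right (x - h) (y - h) (f x)
    rw [dist_sub_right] at h3
    rw [← hxy] at h2
    linarith [hS hx.1 hy.1 hne]
  exact ⟨Set.Finite.of_injOn hmaps hinj ht, Set.ncard_le_ncard_of_injOn f hmaps hinj ht⟩

theorem IsDelone.countable {S : Set (Euc d)} (h : IsDelone S) : S.Countable := by
  obtain ⟨r, hr, hS⟩ := h.exists_le_dist
  have hU : S = ⋃ n : ℕ, S ∩ closedBall 0 n := by
    rw [← Set.inter_iUnion, iUnion_closedBall_nat, Set.inter_univ]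
  rw [hU]
  refine Set.countable_iUnion fun n => ?_
  obtain ⟨N, hN⟩ := exists_card_le_of_pairwise_le_dist hr hS n
  exact (hN 0).1.countable

theorem eventually_close (Γ : DeloneKSet d κ) {ε : ℝ} (hε : 0 < ε) :
    ∀ᶠ Γ' in 𝓝 Γ, Close ε Γ'.pts Γ.pts := by
  filter_upwards [Metric.ball_mem_nhds Γ (lt_min hε cap_pos)] with Γ' h
  apply close_of_rubberDistAux_lt
  by_contra hcon
  push Not at hcon
  exact absurd h (not_lt.2 (min_le_min_right _ hcon))

/-- Hitting an open set and missing a compact one are the open conditions of the Fell topology. The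
local study of cylinders uses the rubber metric only through these two. -/
theorem isOpen_setOf_inter_nonempty (i : Fin κ) {V : Set (Euc d)} (hV : IsOpen V) :
    IsOpen {Γ : DeloneKSet d κ | (Γ.pts i ∩ V).Nonempty} := by
  rw [isOpen_iff_eventually]
  rintro Γ ⟨x, hx, hxV⟩
  obtain ⟨e, he, heV⟩ := Metric.isOpen_iff.1 hV x hxV
  have hn : 0 < 1 / (‖x‖ + 1) := by positivity
  filter_upwards [eventually_close Γ (lt_min he hn)] with Γ' h
  obtain ⟨y, hy, hd⟩ := (close_iff.1 h i).1 x hx (by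
    have h1 : ‖x‖ + 1 ≤ 1 / min e (1 / (‖x‖ + 1)) := by
      rw [le_one_div (by positivity) (lt_min he hn)]
      exact min_le_right _ _
    linarith)
  exact ⟨y, hy, heV (by rw [mem_ball']; exact hd.trans_le (min_le_left _ _))⟩

theorem isOpen_setOf_disjoint (i : Fin κ) {K : Set (Euc d)} (hK : IsCompact K) :
    IsOpen {Γ : DeloneKSet d κ | Disjoint (Γ.pts i) K} := by
  rw [isOpen_iff_eventually]
  intro Γ hΓ
  obtain ⟨e, he, heK⟩ := hK.exists_cthickening_subset_open (Γ.delone i).isClosed.isOpen_compl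
    (Set.subset_compl_iff_disjoint_left.2 hΓ)
  obtain ⟨R, hR, hKR⟩ := hK.isBounded.exists_pos_norm_lt
  have hn : 0 < 1 / R := by positivity
  filter_upwards [eventually_close Γ (lt_min he hn)] with Γ' h
  refine Set.disjoint_left.2 fun x hx hxK => ?_
  obtain ⟨y, hy, hd⟩ := (close_iff.1 h i).2 x hx (by
    have h1 : R ≤ 1 / min e (1 / R) := by
      rw [le_one_div (by positivity) (lt_min he hn)]
      exact min_le_right _ _
    linarith [hKR x hxK])
  refine heK (thickening_subset_cthickening _ _ (mem_thickening_iff.2 ⟨x, hxK, ?_⟩)) hy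
  rw [dist_comm]
  exact hd.trans_le (min_le_left _ _)

/-- The points of one colour of the elements of the hull are separated as those of `Λ`. -/
theorem pairwise_le_dist_of_mem_hull (Λ : DeloneKSet d κ) {r : ℝ}
    (hr : ∀ i, (Λ.pts i).Pairwise fun x y => r ≤ dist x y) {Γ : DeloneKSet d κ} (hΓ : Γ ∈ hull Λ)
    (i : Fin κ) : (Γ.pts i).Pairwise fun x y => r ≤ dist x y := by
  intro x hx y hy hne
  by_contra hlt
  push Not at hlt
  have hpos := dist_pos.2 hne
  -- The slack e is such that points of a translate of Λ within e of x and y are still distinct and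
  -- still closer than r.
  obtain ⟨e, he, he1, he2⟩ : ∃ e : ℝ, 0 < e ∧ 2 * e < dist x y ∧ dist x y + 2 * e < r := by
    refine ⟨min (dist x y / 4) ((r - dist x y) / 4), lt_min (by linarith) (by linarith), ?_, ?_⟩
    · linarith [min_le_left (dist x y / 4) ((r - dist x y) / 4)]
    · linarith [min_le_right (dist x y / 4) ((r - dist x y) / 4)]
  obtain ⟨_, ⟨⟨x', hx', hxx⟩, ⟨y', hy', hyy⟩⟩, ⟨g, rfl⟩⟩ := mem_closure_iff.1 hΓ _
    ((isOpen_setOf_inter_nonempty i (Metric.isOpen_ball (x := x) (ε := e))).inter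
      (isOpen_setOf_inter_nonempty i (Metric.isOpen_ball (x := y) (ε := e))))
    ⟨⟨x, hx, mem_ball_self he⟩, ⟨y, hy, mem_ball_self he⟩⟩
  rw [mem_ball] at hxx hyy
  have h1 := dist_triangle4 x x' y' y
  have h2 := dist_triangle4 x' x y y'
  rw [dist_comm x x'] at h1
  rw [dist_comm y y'] at h2
  have hne' : x' + g ≠ y' + g := by
    intro e
    have : x' = y' := add_right_cancel e
    rw [this, dist_self] at h1
    rw [this] at hxx
    linarith
  have : r ≤ dist (x' + g) (y' + g) := hr i hx' hy' hne'
  rw [dist_add_right] at this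
  linarith

theorem lipschitzWith_translate (Γ : DeloneKSet d κ) :
    LipschitzWith 1 fun g => translate g Γ := by
  refine LipschitzWith.of_dist_le_mul fun g g' => ?_
  rw [NNReal.coe_one, one_mul]
  refine le_of_forall_pos_le_add fun ε hε => (min_le_left _ _).trans ?_
  have hpos : 0 < dist g g' + ε := by positivity
  refine rubberDistAux_le hpos (close_iff.2 fun i => ⟨fun x hx _ => ?_, fun x hx _ => ?_⟩)
  · refine ⟨x + g' - g, by simpa [translate] using hx, ?_⟩
    have : dist x (x + g' - g) = dist g g' := by
      rw [dist_eq_norm, dist_eq_norm]; congr 1; abel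
    linarith
  · refine ⟨x + g - g', by simpa [translate] using hx, ?_⟩
    have : dist x (x + g - g') = dist g g' := by
      rw [dist_eq_norm, dist_eq_norm, ← norm_neg]; congr 1; abel
    linarith

/-- Joint continuity provides the measurability that Fubini needs. It follows from continuity in Γ
because the Lipschitz constant in g is the same for all Γ. -/
theorem continuous_translate_uncurry :
    Continuous fun p : Euc d × DeloneKSet d κ => translate p.1 p.2 :=
  continuous_prod_of_continuous_lipschitzWith _ 1 (fun g => continuous_translate g)
    fun Γ => lipschitzWith_translate Γ

theorem continuous_hullTranslate_uncurry (Λ : DeloneKSet d κ) :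
    Continuous fun p : Euc d × hull Λ => hullTranslate Λ p.1 p.2 :=
  (continuous_translate_uncurry.comp
    (continuous_fst.prodMk (continuous_subtype_val.comp continuous_snd))).subtype_mk _

theorem continuous_hullTranslate (Λ : DeloneKSet d κ) (g : Euc d) :
    Continuous (hullTranslate Λ g) :=
  (continuous_hullTranslate_uncurry Λ).comp (Continuous.prodMk_right g)

theorem hullTranslate_hullTranslate (Λ : DeloneKSet d κ) (g h : Euc d) (Γ : hull Λ) :
    hullTranslate Λ g (hullTranslate Λ h Γ) = hullTranslate Λ (g + h) Γ :=
  Subtype.ext (translate_translate g h Γ.1)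

theorem translate_zero (Γ : DeloneKSet d κ) : translate 0 Γ = Γ := by
  ext i x
  simp [translate]

/-- `Λ` as a point of its hull. -/
def hullBase (Λ : DeloneKSet d κ) : hull Λ :=
  ⟨Λ, subset_closure ⟨0, translate_zero Λ⟩⟩

/-! ### Averages along linear families of translations -/

/-- The time spent in an open set is at most its supremum over the orbit of `Λ`. -/
theorem volume_inter_hullTranslate_le (Λ : DeloneKSet d κ) {f : Euc d →ₗ[ℝ] Euc d}
    (hf : Function.Surjective f) {G : Set (hull Λ)} (hG : IsOpen G) (W : Set (Euc d))
    {b : ENNReal}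
    (hb : ∀ h, volume (W ∩ {s | hullTranslate Λ (f (s + h)) (hullBase Λ) ∈ G}) ≤ b)
    (Γ : hull Λ) : volume (W ∩ {s | hullTranslate Λ (f s) Γ ∈ G}) ≤ b := by
  obtain ⟨u, hu, hlim⟩ := mem_closure_iff_seq_limit.1 Γ.2
  choose g hg using hu
  choose h hh using fun n => hf (g n)
  let Γ' : ℕ → hull Λ := fun n => hullTranslate Λ (f (h n)) (hullBase Λ)
  have hΓ' : Tendsto Γ' atTop (𝓝 Γ) := by
    rw [tendsto_subtype_rng]
    refine hlim.congr fun n => ?_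
    rw [← hg, ← hh]
    rfl
  let S : ℕ → Set (Euc d) := fun n => W ∩ {s | hullTranslate Λ (f s) (Γ' n) ∈ G}
  have hS : ∀ n, volume (S n) ≤ b := by
    intro n
    refine le_trans (measure_mono ?_) (hb (h n))
    rintro s ⟨hs, hsG⟩
    refine ⟨hs, ?_⟩
    simpa [Γ', hullTranslate_hullTranslate] using hsG
  -- As G is open, membership at the limit Γ passes to all late approximants. The intersections
  -- increase with N, so continuity from below preserves the bound.
  have hsub : W ∩ {s | hullTranslate Λ (f s) Γ ∈ G} ⊆ ⋃ N, ⋂ n ≥ N, S n := by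
    rintro s ⟨hs, hsG⟩
    have : ∀ᶠ n in atTop, hullTranslate Λ (f s) (Γ' n) ∈ G :=
      ((continuous_hullTranslate Λ (f s)).tendsto Γ).comp hΓ' (hG.mem_nhds hsG)
    obtain ⟨N, hN⟩ := eventually_atTop.1 this
    exact Set.mem_iUnion.2 ⟨N, Set.mem_iInter₂.2 fun n hn => ⟨hs, hN n hn⟩⟩
  refine (measure_mono hsub).trans ?_
  rw [Monotone.measure_iUnion]
  · exact iSup_le fun N => (measure_mono (Set.iInter₂_subset N le_rfl)).trans (hS N)
  · intro N M hNM
    exact Set.biInter_subset_biInter_left fun n hn => hNM.trans hn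

section Average

variable {Λ : DeloneKSet d κ} {μ : Measure (hull Λ)} [IsProbabilityMeasure μ]
  (hμ : ∀ g : Euc d, MeasurePreserving (hullTranslate Λ g) μ μ)
include hμ

/-- Fubini on W × X_Λ: by invariance the slice at each fixed s has measure μ(G). -/
theorem measure_mul_volume_eq_lintegral {f : Euc d →ₗ[ℝ] Euc d}
    {G : Set (hull Λ)} (hG : MeasurableSet G) {W : Set (Euc d)} (hW : MeasurableSet W) :
    μ G * volume W = ∫⁻ Γ, volume (W ∩ {s | hullTranslate Λ (f s) Γ ∈ G}) ∂μ := by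
  have hc : Continuous fun p : Euc d × hull Λ => hullTranslate Λ (f p.1) p.2 :=
    (continuous_hullTranslate_uncurry Λ).comp
      ((f.continuous_of_finiteDimensional.comp continuous_fst).prodMk continuous_snd)
  have hm : MeasurableSet {p : Euc d × hull Λ | hullTranslate Λ (f p.1) p.2 ∈ G} :=
    hc.measurable hG
  have e1 := Measure.prod_apply (μ := volume.restrict W) (ν := μ) hm
  have e2 := Measure.prod_apply_symm (μ := volume.restrict W) (ν := μ) hm
  rw [e1] at e2
  have e3 : ∀ s : Euc d,
      μ (Prod.mk s ⁻¹' {p : Euc d × hull Λ | hullTranslate Λ (f p.1) p.2 ∈ G}) = μ G :=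
    fun s => (hμ (f s)).measure_preimage hG.nullMeasurableSet
  simp only [e3, lintegral_const, Measure.restrict_apply_univ] at e2
  rw [e2]
  refine lintegral_congr fun Γ => ?_
  rw [Measure.restrict_apply' hW, Set.inter_comm]
  rfl

/-- The substitute for an ergodic theorem: a bound that is uniform along the single orbit of Λ
passes to every invariant measure, for open sets and from above only. -/
theorem measure_mul_volume_le {f : Euc d →ₗ[ℝ] Euc d} (hf : Function.Surjective f)
    {G : Set (hull Λ)} (hG : IsOpen G) {W : Set (Euc d)} (hW : MeasurableSet W) {b : ENNReal}
    (hb : ∀ h, volume (W ∩ {s | hullTranslate Λ (f (s + h)) (hullBase Λ) ∈ G}) ≤ b) :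
    μ G * volume W ≤ b := by
  rw [measure_mul_volume_eq_lintegral hμ (f := f) hG.measurableSet hW]
  calc _ ≤ ∫⁻ _, b ∂μ := lintegral_mono fun Γ => volume_inter_hullTranslate_le Λ hf hG W hb Γ
    _ = b := by simp

end Average

/-! ### The frontier of a grid cylinder -/

/-- No point of `Γ` lies on a hyperplane of the grid of mesh `2^{-m}`. -/
def OffGrid (m : ℕ) (Γ : DeloneKSet d κ) : Prop :=
  ∀ i, ∀ p ∈ Γ.pts i, ∀ (l : Fin d) (k : ℤ), p l ≠ (k : ℝ) / 2 ^ m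

/-- The open grid cube. -/
def openCube (m : ℕ) (k : Fin d → ℤ) : Set (Euc d) :=
  {x | ∀ l, (k l : ℝ) / 2 ^ m < x l ∧ x l < ((k l : ℝ) + 1) / 2 ^ m}

/-- The closed grid cube. -/
def closedCube (m : ℕ) (k : Fin d → ℤ) : Set (Euc d) :=
  {x | ∀ l, (k l : ℝ) / 2 ^ m ≤ x l ∧ x l ≤ ((k l : ℝ) + 1) / 2 ^ m}

theorem isOpen_openCube (m : ℕ) (k : Fin d → ℤ) : IsOpen (openCube m k) := by
  simp only [openCube, Set.ofPred_forall]
  refine isOpen_iInter_of_finite fun l => ?_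
  have hc : Continuous fun x : Euc d => x l := (EuclideanSpace.proj (𝕜 := ℝ) l).continuous
  exact (isOpen_lt continuous_const hc).inter (isOpen_lt hc continuous_const)

theorem isCompact_closedCube (m : ℕ) (k : Fin d → ℤ) : IsCompact (closedCube m k) := by
  have h := (EuclideanSpace.equiv (Fin d) ℝ).toHomeomorph.isCompact_preimage.2
    (isCompact_univ_pi fun l : Fin d =>
      isCompact_Icc (a := (k l : ℝ) / 2 ^ m) (b := ((k l : ℝ) + 1) / 2 ^ m))
  convert! h using 1
  ext x
  simp [closedCube, Pi.le_def, forall_and]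

theorem openCube_subset_gridCube (m : ℕ) (k : Fin d → ℤ) : openCube m k ⊆ gridCube m k :=
  fun _ hx l => ⟨(hx l).1.le, (hx l).2⟩

theorem gridCube_subset_closedCube (m : ℕ) (k : Fin d → ℤ) : gridCube m k ⊆ closedCube m k :=
  fun _ hx l => ⟨(hx l).1, (hx l).2.le⟩

theorem OffGrid.mem_openCube {m : ℕ} {Γ : DeloneKSet d κ} (hΓ : OffGrid m Γ) {i : Fin κ}
    {p : Euc d} (hp : p ∈ Γ.pts i) {k : Fin d → ℤ} (hpk : p ∈ closedCube m k) :
    p ∈ openCube m k := by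
  intro l
  refine ⟨lt_of_le_of_ne (hpk l).1 (hΓ i p hp l (k l)).symm, lt_of_le_of_ne (hpk l).2 ?_⟩
  have := hΓ i p hp l (k l + 1)
  push_cast at this
  exact this

theorem gridCube_subset_window {m : ℕ} {C : (Fin d → ℤ) × Fin κ} (hC : C ∈ colouredCubes d κ m) :
    gridCube m C.1 ⊆ window d m := by
  intro x hx l
  have h2 : (0 : ℝ) < 2 ^ m := by positivity
  have h4 : (4 : ℝ) ^ m = 2 ^ m * 2 ^ m := by rw [← mul_pow]; norm_num
  obtain ⟨h1, h1'⟩ := hC l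
  have h1r : -(4 : ℝ) ^ m ≤ C.1 l := by exact_mod_cast h1
  have h1r' : (C.1 l : ℝ) + 1 ≤ 4 ^ m := by exact_mod_cast h1'
  obtain ⟨h3, h3'⟩ := hx l
  rw [div_le_iff₀ h2] at h3
  rw [lt_div_iff₀ h2] at h3'
  constructor
  · refine le_of_mul_le_mul_right ?_ h2
    linarith
  · refine lt_of_mul_lt_mul_right ?_ h2.le
    linarith

theorem finite_colouredCubes (d κ m : ℕ) : (colouredCubes d κ m).Finite := by
  refine ((Set.finite_Icc (fun _ : Fin d => -(4 : ℤ) ^ m) fun _ => 4 ^ m).prod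
    (Set.finite_univ (α := Fin κ))).subset ?_
  intro C hC
  exact ⟨⟨fun l => (hC l).1, fun l => (hC l).2.le⟩, trivial⟩

theorem isBounded_window (d m : ℕ) : Bornology.IsBounded (window d m) := by
  have h := (EuclideanSpace.equiv (Fin d) ℝ).toHomeomorph.isCompact_preimage.2
    (isCompact_univ_pi fun _ : Fin d => isCompact_Icc (a := -(2 : ℝ) ^ m) (b := 2 ^ m))
  refine h.isBounded.subset fun x hx => ?_
  simpa [Pi.le_def, forall_and] using
    And.intro (fun l => (hx l).1) (fun l => (hx l).2.le)

theorem IsDelone.finite_inter {S T : Set (Euc d)} (hS : IsDelone S) (hT : Bornology.IsBounded T) :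
    (S ∩ T).Finite := by
  obtain ⟨r, hr, hsep⟩ := hS.exists_le_dist
  obtain ⟨R, hR⟩ := hT.subset_closedBall 0
  obtain ⟨N, hN⟩ := exists_card_le_of_pairwise_le_dist hr hsep R
  exact (hN 0).1.subset (Set.inter_subset_inter_right _ hR)

theorem mem_gridCylinder_iff {Λ : DeloneKSet d κ} {m : ℕ} {Δ : Set ((Fin d → ℤ) × Fin κ)}
    (hΔ : Δ ⊆ colouredCubes d κ m) (Γ : hull Λ) :
    Γ ∈ gridCylinder Λ m Δ ↔ ∀ C ∈ colouredCubes d κ m,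
      (C ∈ Δ → ∃ p, Γ.1.pts C.2 ∩ gridCube m C.1 = {p}) ∧
      (C ∉ Δ → Γ.1.pts C.2 ∩ gridCube m C.1 = ∅) := by
  have hw : ∀ C ∈ colouredCubes d κ m, Γ.1.pts C.2 ∩ window d m ∩ gridCube m C.1 =
      Γ.1.pts C.2 ∩ gridCube m C.1 := fun C hC => by
    rw [Set.inter_assoc, Set.inter_eq_self_of_subset_right (gridCube_subset_window hC)]
  constructor
  · rintro ⟨-, -, h1, h2⟩ C hC
    refine ⟨fun h => ?_, fun h => ?_⟩
    · rw [← hw C hC]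
      exact h1 C h
    · rw [← hw C hC]
      exact h2 C ⟨hC, h⟩
  · intro h
    refine ⟨fun i => Set.inter_subset_right,
      fun i => (Γ.1.delone i).finite_inter (isBounded_window d m), fun C hC => ?_, fun C hC => ?_⟩
    · simpa only [hw C (hΔ hC)] using (h C (hΔ hC)).1 hC
    · simpa only [hw C hC.1] using (h C hC.1).2 hC.2

/-- Near an element of the hull that avoids the grid, the colour `i` part in a grid cube keeps
being empty or not, and keeps being a singleton or not. -/
theorem OffGrid.eventually_iff {Λ : DeloneKSet d κ} {m : ℕ} {Γ : hull Λ} (hΓ : OffGrid m Γ.1)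
    (k : Fin d → ℤ) (i : Fin κ) :
    ∀ᶠ Γ' : hull Λ in 𝓝 Γ,
      ((Γ'.1.pts i ∩ gridCube m k = ∅ ↔ Γ.1.pts i ∩ gridCube m k = ∅) ∧
      ((∃ p, Γ'.1.pts i ∩ gridCube m k = {p}) ↔ ∃ p, Γ.1.pts i ∩ gridCube m k = {p})) := by
  have hhit : ∀ V : Set (Euc d), IsOpen V → (Γ.1.pts i ∩ V).Nonempty →
      ∀ᶠ Γ' : hull Λ in 𝓝 Γ, (Γ'.1.pts i ∩ V).Nonempty := fun V hV hne =>
    continuous_subtype_val.continuousAt.eventually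
      ((isOpen_setOf_inter_nonempty i hV).mem_nhds hne)
  have hmiss : ∀ K : Set (Euc d), IsCompact K → Disjoint (Γ.1.pts i) K →
      ∀ᶠ Γ' : hull Λ in 𝓝 Γ, Disjoint (Γ'.1.pts i) K := fun K hK hne =>
    continuous_subtype_val.continuousAt.eventually ((isOpen_setOf_disjoint i hK).mem_nhds hne)
  have hopen : ∀ p ∈ Γ.1.pts i ∩ gridCube m k, p ∈ openCube m k := fun p hp =>
    hΓ.mem_openCube hp.1 (gridCube_subset_closedCube m k hp.2)
  rcases Set.eq_empty_or_nonempty (Γ.1.pts i ∩ gridCube m k) with h0 | ⟨p, hp⟩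
  · have hd : Disjoint (Γ.1.pts i) (closedCube m k) := by
      refine Set.disjoint_left.2 fun p hp hpk => ?_
      have : p ∈ Γ.1.pts i ∩ gridCube m k :=
        ⟨hp, openCube_subset_gridCube m k (hΓ.mem_openCube hp hpk)⟩
      rw [h0] at this
      exact this
    filter_upwards [hmiss _ (isCompact_closedCube m k) hd] with Γ' h'
    have : Γ'.1.pts i ∩ gridCube m k = ∅ :=
      (h'.mono_right (gridCube_subset_closedCube m k)).inter_eq
    rw [this, h0]
    exact ⟨Iff.rfl, Iff.rfl⟩
  · by_cases hs : ∃ p, Γ.1.pts i ∩ gridCube m k = {p}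
    · obtain ⟨p', hp'⟩ := hs
      obtain rfl : p = p' := by rw [hp'] at hp; exact hp
      -- A ball of radius at most r/2 about p holds at most one point of a nearby element; the rest
      -- of the closed cube is compact and free of points of Γ, hence stays free.
      obtain ⟨r, hr, hsep⟩ := Λ.delone_supp.exists_le_dist
      have hsep' := fun j => hsep.mono (Set.subset_iUnion Λ.pts j)
      obtain ⟨e, he, hep⟩ := Metric.isOpen_iff.1 (isOpen_openCube m k) p (hopen p hp)
      set e' := min e (r / 2) with he'
      have he'pos : 0 < e' := lt_min he (half_pos hr)
      have hK : IsCompact (closedCube m k \ ball p e') := (isCompact_closedCube m k).diff isOpen_ball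
      have hd : Disjoint (Γ.1.pts i) (closedCube m k \ ball p e') := by
        refine Set.disjoint_left.2 fun q hq hqk => ?_
        have : q ∈ Γ.1.pts i ∩ gridCube m k :=
          ⟨hq, openCube_subset_gridCube m k (hΓ.mem_openCube hq hqk.1)⟩
        rw [hp'] at this
        obtain rfl : q = p := this
        exact hqk.2 (mem_ball_self he'pos)
      filter_upwards [hmiss _ hK hd, hhit _ isOpen_ball ⟨p, hp.1, mem_ball_self he'pos⟩]
        with Γ' h1 h2
      obtain ⟨q, hq, hqp⟩ := h2
      have hqk : q ∈ Γ'.1.pts i ∩ gridCube m k := ⟨hq, openCube_subset_gridCube m k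
        (hep (ball_subset_ball (min_le_left _ _) hqp))⟩
      have hone : Γ'.1.pts i ∩ gridCube m k = {q} := by
        refine Set.eq_singleton_iff_unique_mem.2 ⟨hqk, fun q' hq' => ?_⟩
        have hq'p : q' ∈ ball p e' := by
          by_contra hcon
          exact Set.disjoint_left.1 h1 hq'.1 ⟨gridCube_subset_closedCube m k hq'.2, hcon⟩
        by_contra hne
        have h3 : r ≤ dist q' q :=
          pairwise_le_dist_of_mem_hull Λ hsep' Γ'.2 i hq'.1 hq hne
        have h4 := dist_triangle_right q' q p
        rw [mem_ball] at hqp hq'p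
        have := min_le_right e (r / 2)
        linarith
      refine ⟨?_, ?_⟩
      · rw [hone, hp']; simp
      · rw [hone, hp']; simp
    · obtain ⟨q, hq, hqp⟩ : ∃ q ∈ Γ.1.pts i ∩ gridCube m k, q ≠ p := by
        by_contra! hcon
        exact hs ⟨p, Set.eq_singleton_iff_unique_mem.2 ⟨hp, hcon⟩⟩
      obtain ⟨V, V', hV, hV', hqV, hpV', hVV'⟩ := t2_separation hqp
      filter_upwards [hhit _ (hV.inter (isOpen_openCube m k)) ⟨q, hq.1, hqV, hopen q hq⟩,
        hhit _ (hV'.inter (isOpen_openCube m k)) ⟨p, hp.1, hpV', hopen p hp⟩] with Γ' h1 h2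
      obtain ⟨q', hq', hqV', hqk'⟩ := h1
      obtain ⟨p', hp', hpV', hpk'⟩ := h2
      have a1 : q' ∈ Γ'.1.pts i ∩ gridCube m k := ⟨hq', openCube_subset_gridCube m k hqk'⟩
      have a2 : p' ∈ Γ'.1.pts i ∩ gridCube m k := ⟨hp', openCube_subset_gridCube m k hpk'⟩
      refine ⟨iff_of_false (Set.Nonempty.ne_empty ⟨q', a1⟩) (Set.Nonempty.ne_empty ⟨p, hp⟩),
        iff_of_false ?_ hs⟩
      rintro ⟨c, hc⟩
      rw [hc] at a1 a2
      have : q' = p' := Eq.trans a1 (Eq.symm a2)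
      exact Set.disjoint_left.1 hVV' hqV' (this ▸ hpV')

theorem not_offGrid_of_mem_frontier {Λ : DeloneKSet d κ} {m : ℕ} {Δ : Set ((Fin d → ℤ) × Fin κ)}
    (hΔ : Δ ⊆ colouredCubes d κ m) {Γ : hull Λ} (hfr : Γ ∈ frontier (gridCylinder Λ m Δ)) :
    ¬ OffGrid m Γ.1 := by
  intro hΓ
  have hev : ∀ᶠ Γ' : hull Λ in 𝓝 Γ, (Γ' ∈ gridCylinder Λ m Δ ↔ Γ ∈ gridCylinder Λ m Δ) := by
    have := (finite_colouredCubes d κ m).eventually_all.2 fun C _ => hΓ.eventually_iff C.1 C.2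
    filter_upwards [this] with Γ' h
    rw [mem_gridCylinder_iff hΔ, mem_gridCylinder_iff hΔ]
    exact forall₂_congr fun C hC => by rw [(h C hC).1, (h C hC).2]
  by_cases hmem : Γ ∈ gridCylinder Λ m Δ
  · exact hfr.2 (mem_interior_iff_mem_nhds.2 (by filter_upwards [hev] with Γ' h using h.2 hmem))
  · have h1 := mem_closure_iff_frequently.1 hfr.1
    exact h1 (by filter_upwards [hev] with Γ' h using fun h' => hmem (h.1 h'))

theorem volume_setOf_apply_eq {f : Euc d →ₗ[ℝ] Euc d} (hf : Function.Surjective f) (l : Fin d)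
    (c : ℝ) : volume {s : Euc d | f s l = c} = 0 := by
  let φ : Euc d →ₗ[ℝ] ℝ := (EuclideanSpace.proj l : Euc d →L[ℝ] ℝ).toLinearMap ∘ₗ f
  have hφ : ∃ v, φ v = 1 := by
    obtain ⟨v, hv⟩ := hf (EuclideanSpace.single l 1)
    exact ⟨v, by simp [φ, hv]⟩
  obtain ⟨v, hv⟩ := hφ
  have hne : LinearMap.ker φ ≠ ⊤ := by
    intro h
    have : v ∈ LinearMap.ker φ := h ▸ Submodule.mem_top
    rw [LinearMap.mem_ker, hv] at this
    exact one_ne_zero this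
  have h0 := Measure.addHaar_submodule volume (LinearMap.ker φ) hne
  have : {s : Euc d | f s l = c} = (fun s => s + (-(c • v))) ⁻¹' (LinearMap.ker φ : Set (Euc d)) := by
    ext s
    have : φ s = f s l := rfl
    simp [hv, this, ← sub_eq_add_neg, sub_eq_zero]
  rw [this, measure_preimage_add_right, h0]

/-- For almost every translation in a linear family, the translate avoids the grid. -/
theorem volume_setOf_not_offGrid (m : ℕ) (Γ : DeloneKSet d κ) {f : Euc d →ₗ[ℝ] Euc d}
    (hf : Function.Surjective f) (c : Euc d) :
    volume {s : Euc d | ¬ OffGrid m (translate (f s + c) Γ)} = 0 := by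
  have hsub : {s : Euc d | ¬ OffGrid m (translate (f s + c) Γ)} ⊆
      ⋃ i : Fin κ, ⋃ p ∈ Γ.pts i, ⋃ l : Fin d, ⋃ k : ℤ,
        {s | f s l = p l - c l - (k : ℝ) / 2 ^ m} := by
    intro s hs
    simp only [OffGrid, Set.mem_ofPred_eq, not_forall, not_not] at hs
    obtain ⟨i, p, hp, l, k, hk⟩ := hs
    simp only [Set.mem_iUnion]
    refine ⟨i, p + (f s + c), hp, l, k, ?_⟩
    simp only [Set.mem_ofPred_eq, PiLp.add_apply, ← hk]
    ring
  refine measure_mono_null hsub ?_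
  refine measure_iUnion_null fun i => ?_
  refine (measure_biUnion_null_iff (Γ.delone i).countable).2 fun p _ => ?_
  exact measure_iUnion_null fun l => measure_iUnion_null fun k => volume_setOf_apply_eq hf l _

/-- The translates of any Γ that meet the grid form a null set of parameters, so every orbit spends
zero time in the frontier; integrating over X_Λ gives the claim. -/
theorem measure_frontier_gridCylinder {Λ : DeloneKSet d κ} {μ : Measure (hull Λ)}
    [IsProbabilityMeasure μ] (hμ : ∀ g : Euc d, MeasurePreserving (hullTranslate Λ g) μ μ)
    {m : ℕ} {Δ : Set ((Fin d → ℤ) × Fin κ)} (hΔ : Δ ⊆ colouredCubes d κ m) :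
    μ (frontier (gridCylinder Λ m Δ)) = 0 := by
  have h := measure_mul_volume_eq_lintegral hμ (f := LinearMap.id)
    (isClosed_frontier (s := gridCylinder Λ m Δ)).measurableSet
    (measurableSet_closedBall (x := (0 : Euc d)) (ε := 1))
  have h0 : ∀ Γ : hull Λ, volume (closedBall (0 : Euc d) 1 ∩
      {s | hullTranslate Λ ((LinearMap.id : Euc d →ₗ[ℝ] Euc d) s) Γ ∈
        frontier (gridCylinder Λ m Δ)}) = 0 := by
    intro Γ
    refine measure_mono_null ?_ (volume_setOf_not_offGrid m Γ.1
      (f := LinearMap.id) Function.surjective_id 0)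
    rintro s ⟨-, hs⟩
    have := not_offGrid_of_mem_frontier hΔ hs
    simpa [hullTranslate] using this
  simp only [h0, lintegral_zero] at h
  exact (mul_eq_zero.1 h).resolve_right (measure_closedBall_pos volume _ one_pos).ne'

/-! ### Expansive maps -/

/-- Iterating in the adapted metric and comparing with the norm only at the two ends keeps K = b/a
independent of n. -/
theorem IsExpansive.exists_pow_mul_norm_le {Q : Euc d →ₗ[ℝ] Euc d} (hQ : IsExpansive Q) :
    ∃ K c : ℝ, 0 < K ∧ 1 < c ∧ ∀ (n : ℕ) (x : Euc d), c ^ n * ‖x‖ ≤ K * ‖(Q ^ n) x‖ := by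
  obtain ⟨ρ, c, hc, ⟨a, b, ha, hb, hab⟩, hρ⟩ := hQ
  refine ⟨b / a, c, by positivity, hc, fun n x => ?_⟩
  have key : ∀ n : ℕ, c ^ n * ρ.dist x 0 ≤ ρ.dist ((Q ^ n) x) 0 := by
    intro n
    induction n with
    | zero => simp
    | succ n ih =>
      have h1 := hρ ((Q ^ n) x) 0
      rw [map_zero] at h1
      rw [pow_succ', pow_succ', Module.End.mul_apply]
      calc c * c ^ n * ρ.dist x 0 = c * (c ^ n * ρ.dist x 0) := by ring
        _ ≤ c * ρ.dist ((Q ^ n) x) 0 := by gcongr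
        _ ≤ _ := h1
  have h1 := (hab x 0).1
  have h2 := (hab ((Q ^ n) x) 0).2
  rw [dist_zero_right] at h1 h2
  have h3 : c ^ n * (a * ‖x‖) ≤ b * ‖(Q ^ n) x‖ :=
    (mul_le_mul_of_nonneg_left h1 (by positivity)).trans ((key n).trans h2)
  rw [div_mul_eq_mul_div, le_div_iff₀ ha]
  linarith

theorem IsExpansive.injective_pow {Q : Euc d →ₗ[ℝ] Euc d} (hQ : IsExpansive Q) (n : ℕ) :
    Function.Injective (Q ^ n) := by
  obtain ⟨K, c, hK, hc, h⟩ := hQ.exists_pow_mul_norm_le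
  rw [injective_iff_map_eq_zero]
  intro x hx
  have := h n x
  rw [hx, norm_zero, mul_zero] at this
  have hcn : 0 < c ^ n := by positivity
  exact norm_le_zero_iff.1 (nonpos_of_mul_nonpos_right this hcn)

theorem IsExpansive.surjective_pow {Q : Euc d →ₗ[ℝ] Euc d} (hQ : IsExpansive Q) (n : ℕ) :
    Function.Surjective (Q ^ n) :=
  LinearMap.injective_iff_surjective.1 (hQ.injective_pow n)

theorem IsExpansive.det_pow_ne_zero {Q : Euc d →ₗ[ℝ] Euc d} (hQ : IsExpansive Q) (n : ℕ) :
    LinearMap.det (Q ^ n) ≠ 0 := by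
  have := LinearEquiv.isUnit_det' (LinearEquiv.ofBijective (Q ^ n)
    ⟨hQ.injective_pow n, hQ.surjective_pow n⟩)
  exact this.ne_zero

/-- The preimages of a ball under the powers of an expansive map shrink to the origin. -/
theorem IsExpansive.exists_norm_le {Q : Euc d →ₗ[ℝ] Euc d} (hQ : IsExpansive Q) (R : ℝ) {ε : ℝ}
    (hε : 0 < ε) : ∃ n₀ : ℕ, ∀ n ≥ n₀, ∀ t, ‖(Q ^ n) t‖ ≤ R → ‖t‖ ≤ ε := by
  obtain ⟨K, c, hK, hc, h⟩ := hQ.exists_pow_mul_norm_le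
  have hlim := (tendsto_pow_atTop_atTop_of_one_lt hc).eventually_ge_atTop (K * R / ε)
  obtain ⟨n₀, hn₀⟩ := eventually_atTop.1 hlim
  refine ⟨n₀, fun n hn t ht => ?_⟩
  have h1 := hn₀ n hn
  rw [div_le_iff₀ hε] at h1
  have hcn : 0 < c ^ n := by positivity
  have h2 : c ^ n * ‖t‖ ≤ c ^ n * ε := (h n t).trans ((by gcongr : _ ≤ K * R).trans h1)
  exact le_of_mul_le_mul_left h2 hcn

/-! ### Iterated digit sets -/

/-- The digit sets of the powers of a substitution: `ω^n (T_j) = {u + T_i : u ∈ D^{(n)} i j}`. -/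
def iterDigits (Q : Euc d →ₗ[ℝ] Euc d) (D : Fin κ → Fin κ → Finset (Euc d)) :
    ℕ → Fin κ → Fin κ → Set (Euc d)
  | 0, i, j => {u | i = j ∧ u = 0}
  | n + 1, i, j => {v | ∃ k, ∃ u ∈ iterDigits Q D n k j, ∃ w ∈ D i k, v = Q u + w}

section Digits

variable {Q : Euc d →ₗ[ℝ] Euc d} {D : Fin κ → Fin κ → Finset (Euc d)}
  {Λ : DeloneKSet d κ} {A : Fin κ → Set (Euc d)}

theorem IsSubstitution.mem_pts_iff_one (h : IsSubstitution Q D Λ) (i : Fin κ) (y : Euc d) :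
    y ∈ Λ.pts i ↔ ∃ j, ∃ x ∈ Λ.pts j, ∃ u ∈ D i j, y = Q x + u := by
  rw [h.eq_iUnion i]
  simp only [Set.mem_iUnion, Set.mem_add, Set.mem_image, Finset.mem_coe]
  constructor
  · rintro ⟨j, _, ⟨x, hx, rfl⟩, u, hu, rfl⟩
    exact ⟨j, x, hx, u, hu, rfl⟩
  · rintro ⟨j, x, hx, u, hu, rfl⟩
    exact ⟨j, _, ⟨x, hx, rfl⟩, u, hu, rfl⟩

theorem IsSubstitution.mem_pts_iff (h : IsSubstitution Q D Λ) (n : ℕ) (i : Fin κ) (y : Euc d) :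
    y ∈ Λ.pts i ↔ ∃ j, ∃ x ∈ Λ.pts j, ∃ u ∈ iterDigits Q D n i j, y = (Q ^ n) x + u := by
  induction n generalizing i y with
  | zero => simp [iterDigits]
  | succ n ih =>
    rw [h.mem_pts_iff_one]
    constructor
    · rintro ⟨k, x', hx', w, hw, rfl⟩
      obtain ⟨j, x, hx, u, hu, rfl⟩ := (ih k x').1 hx'
      refine ⟨j, x, hx, Q u + w, ⟨k, u, hu, w, hw, rfl⟩, ?_⟩
      rw [pow_succ', Module.End.mul_apply, map_add, add_assoc]
    · rintro ⟨j, x, hx, _, ⟨k, u, hu, w, hw, rfl⟩, rfl⟩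
      refine ⟨k, (Q ^ n) x + u, (ih k _).2 ⟨j, x, hx, u, hu, rfl⟩, w, hw, ?_⟩
      rw [pow_succ', Module.End.mul_apply, map_add, add_assoc]

theorem IsAdjointSolution.exists_image_iff_one (h : IsAdjointSolution Q D A) (j : Fin κ)
    (y : Euc d) : (∃ a ∈ A j, y = Q a) ↔ ∃ i, ∃ w ∈ D i j, ∃ a ∈ A i, y = w + a := by
  have h1 : (∃ a ∈ A j, y = Q a) ↔ y ∈ Q '' A j := by simp [Set.mem_image, eq_comm]
  rw [h1, h.image_eq j]
  simp only [Set.mem_iUnion, Set.mem_add, Finset.mem_coe, eq_comm (a := y)]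

theorem IsAdjointSolution.exists_image_iff (h : IsAdjointSolution Q D A) (n : ℕ) (j : Fin κ)
    (y : Euc d) :
    (∃ a ∈ A j, y = (Q ^ n) a) ↔ ∃ i, ∃ u ∈ iterDigits Q D n i j, ∃ a ∈ A i, y = u + a := by
  induction n generalizing y with
  | zero => simp [iterDigits]
  | succ n ih =>
    constructor
    · rintro ⟨a, ha, rfl⟩
      obtain ⟨k, u, hu, b, hb, hab⟩ := (ih _).1 ⟨a, ha, rfl⟩
      obtain ⟨i, w, hw, e, he, hbe⟩ := (h.exists_image_iff_one k _).1 ⟨b, hb, rfl⟩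
      refine ⟨i, Q u + w, ⟨k, u, hu, w, hw, rfl⟩, e, he, ?_⟩
      rw [pow_succ', Module.End.mul_apply, hab, map_add, hbe, add_assoc]
    · rintro ⟨i, _, ⟨k, u, hu, w, hw, rfl⟩, e, he, rfl⟩
      obtain ⟨b, hb, hbe⟩ := (h.exists_image_iff_one k _).2 ⟨i, w, hw, e, he, rfl⟩
      obtain ⟨a, ha, hab⟩ := (ih _).2 ⟨k, u, hu, b, hb, rfl⟩
      refine ⟨a, ha, ?_⟩
      rw [pow_succ', Module.End.mul_apply, ← hab, map_add, ← hbe, add_assoc]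

/-- The set u + A_i is part of Q^n A_j, so the open preimage of int A_i under s ↦ Q^n s - u lies in
A_j. -/
theorem mem_interior_of_iterDigits (h : IsAdjointSolution Q D A) {n : ℕ}
    (hinj : Function.Injective (Q ^ n)) {i j : Fin κ} {u : Euc d} (hu : u ∈ iterDigits Q D n i j)
    {y : Euc d} (hy : (Q ^ n) y - u ∈ interior (A i)) : y ∈ interior (A j) := by
  refine mem_interior.2 ⟨(fun s => (Q ^ n) s - u) ⁻¹' interior (A i), fun s hs => ?_,
    isOpen_interior.preimage ((Q ^ n).continuous_of_finiteDimensional.sub continuous_const), hy⟩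
  obtain ⟨b, hb, hbe⟩ := (h.exists_image_iff n j ((Q ^ n) s)).2
    ⟨i, u, hu, _, interior_subset hs, (add_sub_cancel u _).symm⟩
  exact hinj hbe ▸ hb

theorem iterDigits_nonempty (n : ℕ) (i j : Fin κ) (h : (substMatrix D ^ n) i j ≠ 0) :
    (iterDigits Q D n i j).Nonempty := by
  induction n generalizing i with
  | zero =>
    refine ⟨0, ?_, rfl⟩
    by_contra hne
    simp [Matrix.one_apply_ne hne] at h
  | succ n ih =>
    rw [pow_succ', Matrix.mul_apply] at h
    obtain ⟨k, -, hk⟩ := Finset.exists_ne_zero_of_sum_ne_zero h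
    obtain ⟨u, hu⟩ := ih k (right_ne_zero_of_mul hk)
    obtain ⟨w, hw⟩ := Finset.card_ne_zero.1 (left_ne_zero_of_mul hk)
    exact ⟨Q u + w, k, u, hu, w, hw, rfl⟩

/-- A compact set has no nonzero period: a maximum of the functional ⟨x - y, ·⟩ on S cannot be moved
by x - y within S. -/
theorem eq_of_vadd_eq {S : Set (Euc d)} (hS : IsCompact S) (hne : S.Nonempty) {x y : Euc d}
    (h : x +ᵥ S = y +ᵥ S) : x = y := by
  obtain ⟨a, ha, hmax⟩ := hS.exists_isMaxOn hne
    (f := fun a => inner ℝ (x - y) a) (by fun_prop)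
  have h1 : x +ᵥ a ∈ y +ᵥ S := h ▸ Set.vadd_mem_vadd_set ha
  obtain ⟨b, hb, hab⟩ := h1
  have hb' : b = a + (x - y) := by
    simp only [vadd_eq_add] at hab
    rw [add_sub, eq_sub_iff_add_eq, add_comm b, hab, add_comm]
  have h2 : inner ℝ (x - y) b ≤ inner ℝ (x - y) a := hmax hb
  rw [hb', inner_add_right, real_inner_self_eq_norm_sq] at h2
  have : ‖x - y‖ = 0 := by nlinarith [sq_nonneg ‖x - y‖]
  exact sub_eq_zero.1 (norm_eq_zero.1 this)

theorem IsAdjointSolution.shift_inj (h : IsAdjointSolution Q D A) {x y : Euc d} {i j : Fin κ}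
    (e : Tile.shift x (prototile A i) = Tile.shift y (prototile A j)) : x = y ∧ i = j := by
  have h2 : i = j := congrArg Prod.snd e
  subst h2
  exact ⟨eq_of_vadd_eq (h.isCompact i) (h.nonempty i) (congrArg Prod.fst e), rfl⟩

theorem shift_shift (x y : Euc d) (T : Tile d κ) :
    Tile.shift x (Tile.shift y T) = Tile.shift (x + y) T :=
  Prod.ext (vadd_vadd x y T.1) rfl

/-- A tile determines its position and type (`shift_inj`), so supertiles are coded faithfully by
digits and legality becomes a statement about digit sets. -/
theorem IsAdjointSolution.shift_mem_iterate (h : IsAdjointSolution Q D A) (k : ℕ) (i j : Fin κ)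
    (x : Euc d) : Tile.shift x (prototile A i) ∈ (tileSubst Q D A)^[k] {prototile A j} ↔
      x ∈ iterDigits Q D k i j := by
  induction k generalizing i x with
  | zero =>
    have e : prototile A j = Tile.shift 0 (prototile A j) := Prod.ext (zero_vadd _ _).symm rfl
    rw [Function.iterate_zero, id, Set.mem_singleton_iff, e]
    constructor
    · intro h'
      exact ⟨(h.shift_inj h').2, (h.shift_inj h').1⟩
    · rintro ⟨rfl, rfl⟩
      rfl
  | succ k ih =>
    rw [Function.iterate_succ_apply']
    constructor
    · rintro ⟨l, y, hy, i', u, hu, e⟩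
      obtain ⟨rfl, rfl⟩ := h.shift_inj e
      exact ⟨l, y, (ih l y).1 hy, u, hu, rfl⟩
    · rintro ⟨l, y, hy, u, hu, rfl⟩
      exact ⟨l, y, (ih l y).2 hy, i, u, hu, rfl⟩

theorem exists_iterDigits_of_mem_legalReturnVectors (h : IsAdjointSolution Q D A) {z : Euc d}
    (hz : z ∈ legalReturnVectors Q D Λ A) :
    ∃ k i j u, u ∈ iterDigits Q D k i j ∧ u + z ∈ iterDigits Q D k i j := by
  obtain ⟨P, hP, -, ⟨k, j, v, hleg⟩, T, hT, T', hT', rfl⟩ := hz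
  obtain ⟨i, x, -, rfl⟩ := hP hT
  have h1 := hleg ⟨_, hT, rfl⟩
  have h2 := hleg ⟨_, hT', rfl⟩
  rw [shift_shift, h.shift_mem_iterate] at h1
  rw [shift_shift, shift_shift, h.shift_mem_iterate] at h2
  refine ⟨k, i, j, v + x, h1, ?_⟩
  convert! h2 using 1
  abel

/-! ### The tiling -/

theorem DeloneKSet.pts_nonempty (Λ : DeloneKSet d κ) (i : Fin κ) : (Λ.pts i).Nonempty := by
  obtain ⟨R, -, h⟩ := (Λ.delone i).exists_dist_le
  obtain ⟨y, hy, -⟩ := h 0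
  exact ⟨y, hy⟩

theorem mem_tile_iff {x y : Euc d} {i : Fin κ} :
    y ∈ (Tile.shift x (prototile A i)).1 ↔ y - x ∈ A i := by
  rw [Tile.shift, prototile, Set.mem_vadd_set_iff_neg_vadd_mem, vadd_eq_add, neg_add_eq_sub]

theorem mem_interior_tile_iff {x y : Euc d} {i : Fin κ} :
    y ∈ interior (Tile.shift x (prototile A i)).1 ↔ y - x ∈ interior (A i) := by
  rw [Tile.shift, prototile, interior_vadd, Set.mem_vadd_set_iff_neg_vadd_mem, vadd_eq_add,
    neg_add_eq_sub]

theorem IsRepresentedBy.closure_interior (h : IsRepresentedBy Q D Λ A) (i : Fin κ) :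
    closure (interior (A i)) = A i := by
  obtain ⟨x, hx⟩ := Λ.pts_nonempty i
  have := h.tiling.closure_interior _ ⟨i, x, hx, rfl⟩
  rw [Tile.shift, prototile, interior_vadd, closure_vadd] at this
  exact vadd_left_cancel x this

theorem IsRepresentedBy.exists_sub_mem (h : IsRepresentedBy Q D Λ A) (y : Euc d) :
    ∃ i, ∃ x ∈ Λ.pts i, y - x ∈ A i := by
  have : y ∈ ⋃ T ∈ tiles Λ A, T.1 := h.tiling.covers ▸ Set.mem_univ y
  obtain ⟨T, ⟨i, x, hx, rfl⟩, hy⟩ := Set.mem_iUnion₂.1 this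
  exact ⟨i, x, hx, mem_tile_iff.1 hy⟩

/-- A point in the interior of a tile belongs to no other tile. -/
theorem IsRepresentedBy.eq_of_mem_interior (h : IsRepresentedBy Q D Λ A) {i j : Fin κ}
    {x x' y : Euc d} (hx : x ∈ Λ.pts i) (hx' : x' ∈ Λ.pts j) (hy : y - x ∈ interior (A i))
    (hy' : y - x' ∈ A j) : x = x' ∧ i = j := by
  by_contra hcon
  have hne : Tile.shift x (prototile A i) ≠ Tile.shift x' (prototile A j) :=
    fun e => hcon (h.adjoint.shift_inj e)
  have hd := h.tiling.disjoint _ ⟨i, x, hx, rfl⟩ _ ⟨j, x', hx', rfl⟩ hne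
  rw [← mem_interior_tile_iff] at hy
  rw [← mem_tile_iff, ← h.tiling.closure_interior _ ⟨j, x', hx', rfl⟩] at hy'
  exact Set.disjoint_left.1 (hd.closure_right isOpen_interior) hy hy'

theorem IsRepresentedBy.interior_nonempty (h : IsRepresentedBy Q D Λ A) (i : Fin κ) :
    (interior (A i)).Nonempty := by
  rw [← closure_nonempty_iff, h.closure_interior]
  exact h.adjoint.nonempty i

end Digits

/-! ### The boundaries of the tiles are null sets -/

/-- Fubini on U × E: each translate h + E meets S in volume at least c, while for fixed t the points
h + t stay in W. This avoids packing W by copies of E. -/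
theorem mul_volume_le_of_forall_le {S E U W : Set (Euc d)} (hS : MeasurableSet S)
    (hE : MeasurableSet E) (hU : MeasurableSet U) {c : ENNReal}
    (hc : ∀ h ∈ U, c ≤ volume (E ∩ {t | h + t ∈ S})) (hW : ∀ h ∈ U, ∀ t ∈ E, h + t ∈ W) :
    c * volume U ≤ volume E * volume (W ∩ S) := by
  have hm : MeasurableSet {p : Euc d × Euc d | p.1 + p.2 ∈ S} :=
    (measurable_fst.add measurable_snd) hS
  have e1 := Measure.prod_apply (μ := (volume : Measure (Euc d)).restrict U)
    (ν := (volume : Measure (Euc d)).restrict E) hm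
  have e2 := Measure.prod_apply_symm (μ := (volume : Measure (Euc d)).restrict U)
    (ν := (volume : Measure (Euc d)).restrict E) hm
  rw [e1] at e2
  have h1 : c * volume U ≤ ∫⁻ h in U, (volume.restrict E)
      (Prod.mk h ⁻¹' {p : Euc d × Euc d | p.1 + p.2 ∈ S}) := by
    rw [← setLIntegral_const]
    refine setLIntegral_mono' hU fun h hh => ?_
    rw [Measure.restrict_apply' hE, Set.inter_comm]
    exact hc h hh
  refine h1.trans (e2.le.trans ?_)
  rw [mul_comm, ← setLIntegral_const]
  refine setLIntegral_mono' hE fun t ht => ?_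
  rw [Measure.restrict_apply' hU]
  calc _ ≤ volume ((fun h => h + t) ⁻¹' (W ∩ S)) :=
        measure_mono fun h hh => ⟨hW h hh.2 t ht, hh.1⟩
    _ = volume (W ∩ S) := measure_preimage_add_right _ _ _

section Boundary

variable {Q : Euc d →ₗ[ℝ] Euc d} {D : Fin κ → Fin κ → Finset (Euc d)}
  {Λ : DeloneKSet d κ} {A : Fin κ → Set (Euc d)}

theorem IsAdjointSolution.exists_norm_le (h : IsAdjointSolution Q D A) :
    ∃ ρ : ℝ, 0 < ρ ∧ ∀ i, ∀ a ∈ A i, ‖a‖ ≤ ρ := by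
  obtain ⟨ρ, hρ, hA⟩ := (isCompact_iUnion h.isCompact).isBounded.exists_pos_norm_le
  exact ⟨ρ, hρ, fun i a ha => hA a (Set.mem_iUnion.2 ⟨i, ha⟩)⟩

/-- Every ball of a suitable radius contains a tile of each type. -/
theorem IsAdjointSolution.exists_tile_subset_ball (h : IsAdjointSolution Q D A)
    (Λ : DeloneKSet d κ) :
    ∃ r : ℝ, 0 < r ∧ ∀ i c, ∃ x ∈ Λ.pts i, ∀ a ∈ A i, x + a ∈ closedBall c r := by
  obtain ⟨ρ, hρ, hA⟩ := h.exists_norm_le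
  choose R hR hRd using fun i => (Λ.delone i).exists_dist_le
  obtain ⟨M, hM⟩ := Finite.exists_le R
  refine ⟨max M 0 + ρ, by positivity, fun i c => ?_⟩
  obtain ⟨x, hx, hd⟩ := hRd i c
  refine ⟨x, hx, fun a ha => ?_⟩
  rw [mem_closedBall, dist_eq_norm]
  calc ‖x + a - c‖ = ‖(x - c) + a‖ := by congr 1; abel
    _ ≤ ‖x - c‖ + ‖a‖ := norm_add_le _ _
    _ ≤ max M 0 + ρ := by
      rw [← dist_eq_norm, dist_comm]
      exact add_le_add ((hd.trans (hM i)).trans (le_max_left _ _)) (hA i a ha)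

/-- The union of the boundaries of the tiles. -/
def tilesBoundary (Λ : DeloneKSet d κ) (A : Fin κ → Set (Euc d)) : Set (Euc d) :=
  ⋃ i, ⋃ x ∈ Λ.pts i, (fun y => y - x) ⁻¹' (A i \ interior (A i))

theorem mem_tilesBoundary {y : Euc d} :
    y ∈ tilesBoundary Λ A ↔ ∃ i, ∃ x ∈ Λ.pts i, y - x ∈ A i \ interior (A i) := by
  simp only [tilesBoundary, Set.mem_iUnion, Set.mem_preimage, exists_prop]

theorem IsAdjointSolution.measurableSet_tilesBoundary (h : IsAdjointSolution Q D A) :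
    MeasurableSet (tilesBoundary Λ A) := by
  refine MeasurableSet.iUnion fun i => MeasurableSet.biUnion (Λ.delone i).countable fun x _ => ?_
  exact (measurable_id.sub_const x)
    ((h.isCompact i).isClosed.measurableSet.diff isOpen_interior.measurableSet)

/-- Q^n y lies in some tile of the n-fold subdivision of the tile containing y; were it interior to
that tile, y would be interior to its own. -/
theorem pow_map_mem_tilesBoundary (hsub : IsSubstitution Q D Λ) (hrep : IsRepresentedBy Q D Λ A)
    {y : Euc d} (hy : y ∈ tilesBoundary Λ A) (n : ℕ) : (Q ^ n) y ∈ tilesBoundary Λ A := by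
  rw [mem_tilesBoundary] at hy ⊢
  obtain ⟨j, x, hx, hyA, hyint⟩ := hy
  obtain ⟨i, u, hu, a, ha, he⟩ := (hrep.adjoint.exists_image_iff n j _).1 ⟨_, hyA, rfl⟩
  have ea : (Q ^ n) y - ((Q ^ n) x + u) = a := by
    rw [map_sub] at he
    rw [← sub_sub, he, add_sub_cancel_left]
  refine ⟨i, (Q ^ n) x + u, (hsub.mem_pts_iff n i _).2 ⟨j, x, hx, u, hu, rfl⟩, ea ▸ ha, ?_⟩
  intro hint
  refine hyint (mem_interior_of_iterDigits hrep.adjoint (hsub.expansive.injective_pow n) hu ?_)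
  rw [map_sub, sub_sub]
  exact hint

/-- Lebesgue density. A point whose image under Q^n avoids the boundary avoids it as well. Every
ball of radius r contains the interior of a tile, so pulling back by Q^n shows that the complement
of the boundary fills a fixed proportion of every small ball. -/
theorem volume_tilesBoundary (hsub : IsSubstitution Q D Λ) (hrep : IsRepresentedBy Q D Λ A) :
    volume (tilesBoundary Λ A) = 0 := by
  obtain ⟨r, hr, htile⟩ := hrep.adjoint.exists_tile_subset_ball Λ
  obtain ⟨i, -⟩ := hrep.exists_sub_mem 0
  have hv : 0 < volume (interior (A i)) := isOpen_interior.measure_pos _ (hrep.interior_nonempty i)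
  set V := volume (closedBall (0 : Euc d) r) with hV
  have hV0 : V ≠ 0 := (measure_closedBall_pos volume _ hr).ne'
  have hVtop : V ≠ ⊤ := measure_closedBall_lt_top.ne
  set S : Set (Euc d) := (tilesBoundary Λ A)ᶜ with hSdef
  have hS : MeasurableSet S := hrep.adjoint.measurableSet_tilesBoundary.compl
  have hball : ∀ c, volume (interior (A i)) ≤ volume (closedBall 0 r ∩ {b | c + b ∈ S}) := by
    intro c
    obtain ⟨x, hx, hxr⟩ := htile i c
    rw [← measure_preimage_add_right volume (c - x) (interior (A i))]
    refine measure_mono fun b hb => ?_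
    rw [Set.mem_preimage] at hb
    have hb' : c + b - x ∈ interior (A i) := by
      convert hb using 1; abel
    constructor
    · have := hxr _ (interior_subset hb')
      rw [mem_closedBall, dist_eq_norm] at this ⊢
      convert this using 2
      abel
    · intro hcon
      obtain ⟨j, x', hx', hA, hint⟩ := mem_tilesBoundary.1 hcon
      obtain ⟨rfl, rfl⟩ := hrep.eq_of_mem_interior hx hx' hb' hA
      exact hint hb'
  -- With n so large that the preimage of the r-ball lies in the ball of radius ε/2, its translates
  -- by points of the ball of radius ε/2 stay in the ball of radius ε. The factor |det Q^n|⁻¹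
  -- appears on both sides and cancels.
  have hscale : ∀ x : Euc d, ∀ ε > 0, volume (interior (A i)) * volume (closedBall x (1 / 2 * ε)) ≤
      V * volume (closedBall x ε ∩ S) := by
    intro x ε hε
    obtain ⟨n, hn⟩ := hsub.expansive.exists_norm_le r (half_pos hε)
    have hdet := hsub.expansive.det_pow_ne_zero n
    set q := ENNReal.ofReal |(LinearMap.det (Q ^ n))⁻¹| with hq
    have hq0 : q ≠ 0 := by
      rw [hq, Ne, ENNReal.ofReal_eq_zero, not_le]
      exact abs_pos.2 (inv_ne_zero hdet)
    have hqtop : q ≠ ⊤ := ENNReal.ofReal_ne_top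
    have hcont : Continuous (Q ^ n) := (Q ^ n).continuous_of_finiteDimensional
    have hmain := mul_volume_le_of_forall_le (S := S) (E := (Q ^ n) ⁻¹' closedBall 0 r)
      (U := closedBall x (1 / 2 * ε)) (W := closedBall x ε) (c := q * volume (interior (A i))) hS
      (isClosed_closedBall.preimage hcont).measurableSet isClosed_closedBall.measurableSet
      (fun h _ => by
        refine (mul_le_mul_right (hball ((Q ^ n) h)) q).trans ?_
        rw [hq, ← Measure.addHaar_preimage_linearMap volume hdet]
        refine measure_mono fun t ht => ⟨ht.1, fun hcon => ht.2 ?_⟩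
        rw [← map_add]
        exact pow_map_mem_tilesBoundary hsub hrep hcon n)
      (fun h hh t ht => by
        have h1 := hn n le_rfl t (by simpa using ht)
        rw [mem_closedBall, dist_eq_norm] at hh ⊢
        calc ‖h + t - x‖ = ‖(h - x) + t‖ := by congr 1; abel
          _ ≤ ‖h - x‖ + ‖t‖ := norm_add_le _ _
          _ ≤ ε := by linarith)
    rw [Measure.addHaar_preimage_linearMap volume hdet, mul_assoc, mul_assoc] at hmain
    exact (ENNReal.mul_le_mul_iff_right hq0 hqtop).1 hmain
  have hdens : ∀ᵐ x ∂(volume : Measure (Euc d)), x ∈ S := by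
    filter_upwards [Besicovitch.ae_tendsto_measure_inter_div_of_measurableSet volume hS] with x hx
    by_contra hxS
    rw [Set.indicator_of_notMem hxS] at hx
    set p := ENNReal.ofReal ((1 / 2 : ℝ) ^ Module.finrank ℝ (Euc d))
    have hp0 : p ≠ 0 := by simp [p]
    have hle : volume (interior (A i)) * p / V ≤ 0 := by
      refine ge_of_tendsto hx ?_
      filter_upwards [self_mem_nhdsWithin] with ε hε
      have hε : 0 < ε := hε
      have h1 := hscale x ε hε
      rw [Measure.addHaar_closedBall_mul_of_pos volume x (by norm_num : (0 : ℝ) < 1 / 2),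
        ← Measure.addHaar_closedBall_center volume x ε] at h1
      rw [ENNReal.le_div_iff_mul_le (Or.inl (measure_closedBall_pos volume _ hε).ne')
        (Or.inl measure_closedBall_lt_top.ne),
        ← ENNReal.mul_div_right_comm, mul_assoc, Set.inter_comm]
      exact ENNReal.div_le_of_le_mul' h1
    rw [nonpos_iff_eq_zero, ENNReal.div_eq_zero_iff] at hle
    rcases hle with h | h
    · rcases mul_eq_zero.1 h with h | h
      · exact hv.ne' h
      · exact hp0 h
    · exact hVtop h
  have h0 := mem_ae_iff.1 (show S ∈ ae volume from hdens)
  rwa [hSdef, compl_compl] at h0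

theorem volume_diff_interior (hsub : IsSubstitution Q D Λ) (hrep : IsRepresentedBy Q D Λ A)
    (i : Fin κ) : volume (A i \ interior (A i)) = 0 := by
  obtain ⟨x, hx⟩ := Λ.pts_nonempty i
  rw [← measure_preimage_add_right volume (-x) (A i \ interior (A i))]
  refine measure_mono_null (fun y hy => ?_) (volume_tilesBoundary hsub hrep)
  exact mem_tilesBoundary.2 ⟨i, x, hx, by simpa [sub_eq_add_neg] using hy⟩

end Boundary

/-! ### Occurrences of a pattern in supertiles -/

/-- The set of `g` for which the translate `Λ - g` belongs to `E`. -/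
def visitSet (Λ : DeloneKSet d κ) (E : Set (hull Λ)) : Set (Euc d) :=
  {g | hullTranslate Λ g (hullBase Λ) ∈ E}

/-- The points `s` of a prototile for which the ball of radius `ρ` about `Q^n s` is inside the
interior of the supertile. -/
def tileCore (Q : Euc d →ₗ[ℝ] Euc d) (A : Fin κ → Set (Euc d)) (ρ : ℝ) (n : ℕ) (i : Fin κ) :
    Set (Euc d) :=
  {s | ∀ t, ‖(Q ^ n) t‖ ≤ ρ → s + t ∈ interior (A i)}

/-- The points of the core at which the supertiles of type `i` show an occurrence of the pattern
described by `O`. -/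
def coreVisits (Q : Euc d →ₗ[ℝ] Euc d) (A : Fin κ → Set (Euc d)) (Λ : DeloneKSet d κ)
    (O : Set (Euc d)) (ρ : ℝ) (n : ℕ) (i : Fin κ) : Set (Euc d) :=
  {s | s ∈ tileCore Q A ρ n i ∧ ∀ x ∈ Λ.pts i, (Q ^ n) (x + s) ∈ O}

/-- Membership of `Q^n (x + s)` in `O`, for `s` in the core of `A i`, is the same for all
supertiles of type `i`. -/
def IsCoreInvariant (Q : Euc d →ₗ[ℝ] Euc d) (A : Fin κ → Set (Euc d)) (Λ : DeloneKSet d κ)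
    (O : Set (Euc d)) (ρ : ℝ) : Prop :=
  ∀ n i, ∀ s ∈ tileCore Q A ρ n i, ∀ x ∈ Λ.pts i, ∀ x' ∈ Λ.pts i,
    (Q ^ n) (x + s) ∈ O → (Q ^ n) (x' + s) ∈ O

section Estimates

variable {Q : Euc d →ₗ[ℝ] Euc d} {D : Fin κ → Fin κ → Finset (Euc d)}
  {Λ : DeloneKSet d κ} {A : Fin κ → Set (Euc d)} {O : Set (Euc d)} {ρ : ℝ}

theorem nullMeasurableSet_visitSet {m : ℕ} {Δ : Set ((Fin d → ℤ) × Fin κ)}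
    (hΔ : Δ ⊆ colouredCubes d κ m) {f : Euc d →ₗ[ℝ] Euc d} (hf : Function.Surjective f)
    (c : Euc d) :
    NullMeasurableSet {s | f s + c ∈ visitSet Λ (gridCylinder Λ m Δ)} volume := by
  apply nullMeasurableSet_of_null_frontier
  have hcont : Continuous fun s : Euc d => hullTranslate Λ (f s + c) (hullBase Λ) :=
    (continuous_hullTranslate_uncurry Λ).comp
      ((f.continuous_of_finiteDimensional.add continuous_const).prodMk continuous_const)
  refine measure_mono_null ((hcont.frontier_preimage_subset (gridCylinder Λ m Δ)).trans ?_)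
    (volume_setOf_not_offGrid m Λ hf c)
  exact fun s hs => not_offGrid_of_mem_frontier hΔ hs

theorem exists_isCoreInvariant (hsub : IsSubstitution Q D Λ) (hrep : IsRepresentedBy Q D Λ A)
    (m : ℕ) (Δ : Set ((Fin d → ℤ) × Fin κ)) :
    ∃ ρ, 0 < ρ ∧ IsCoreInvariant Q A Λ (visitSet Λ (gridCylinder Λ m Δ)) ρ := by
  obtain ⟨ρ, hρ, hA⟩ := hrep.adjoint.exists_norm_le
  obtain ⟨w, hw, hwin⟩ := (isBounded_window d m).exists_pos_norm_le
  -- The margin is the radius of the window plus that of a tile, so that a tile attached to any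
  -- point seen in the window lies inside the supertile.
  refine ⟨w + ρ, by positivity, fun n i s hs x hx x' hx' hO => ?_⟩
  have key : ∀ x ∈ Λ.pts i, ∀ x' ∈ Λ.pts i, ∀ j, ∀ y ∈ window d m,
      y + (Q ^ n) (x + s) ∈ Λ.pts j → y + (Q ^ n) (x' + s) ∈ Λ.pts j := by
    intro x hx x' hx' j y hy hyj
    obtain ⟨j', x₁, hx₁, u, hu, he⟩ := (hsub.mem_pts_iff n j _).1 hyj
    obtain ⟨a, ha⟩ := hrep.adjoint.nonempty j
    obtain ⟨b, hb, hbe⟩ := (hrep.adjoint.exists_image_iff n j' _).2 ⟨j, u, hu, a, ha, rfl⟩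
    obtain ⟨t, ht⟩ := hsub.expansive.surjective_pow n (y + a)
    have hst : s + t ∈ interior (A i) := by
      apply hs
      rw [ht]
      exact (norm_add_le _ _).trans (add_le_add (hwin y hy) (hA j a ha))
    have heq : x₁ + b = x + (s + t) := by
      apply hsub.expansive.injective_pow n
      rw [map_add, ← hbe, ← add_assoc, ← he]
      simp only [map_add, ht]
      abel
    -- The supertile that produces the seen point shares a point with the interior of the supertile
    -- at x, so the two coincide. The seen point is thus given by a digit u, which occurs at x' too.
    obtain ⟨rfl, rfl⟩ := hrep.eq_of_mem_interior (y := x + (s + t)) hx hx₁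
      (by rwa [add_sub_cancel_left]) (by rwa [← heq, add_sub_cancel_left])
    refine (hsub.mem_pts_iff n j _).2 ⟨i, x', hx', u, hu, ?_⟩
    rw [map_add] at he ⊢
    have : y + (Q ^ n) s = u := by
      have h' : (Q ^ n) x + (y + (Q ^ n) s) = (Q ^ n) x + u := by rw [← he]; abel
      exact add_left_cancel h'
    rw [← this]
    abel
  have hset : (fun j => (translate ((Q ^ n) (x + s)) Λ).pts j ∩ window d m) =
      fun j => (translate ((Q ^ n) (x' + s)) Λ).pts j ∩ window d m := by
    funext j
    ext y
    exact ⟨fun h => ⟨key x hx x' hx' j y h.2 h.1, h.2⟩,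
      fun h => ⟨key x' hx' x hx j y h.2 h.1, h.2⟩⟩
  change (fun j => (translate ((Q ^ n) (x + s)) Λ).pts j ∩ window d m) ∈ patterns m Δ at hO
  rw [hset] at hO
  exact hO

theorem tileCore_subset (hρ : 0 ≤ ρ) (n : ℕ) (i : Fin κ) : tileCore Q A ρ n i ⊆ A i := fun s hs =>
  interior_subset (by simpa using hs 0 (by simpa using hρ))

/-- The complement is the sum of the closed set (int A_i)ᶜ and a compact set, hence closed. -/
theorem isOpen_tileCore (hQ : IsExpansive Q) (n : ℕ) (i : Fin κ) :
    IsOpen (tileCore Q A ρ n i) := by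
  obtain ⟨K, c, hK, hc, h⟩ := hQ.exists_pow_mul_norm_le
  have hcpt : IsCompact ((Q ^ n) ⁻¹' closedBall 0 ρ) := by
    refine Metric.isCompact_of_isClosed_isBounded
      (isClosed_closedBall.preimage (Q ^ n).continuous_of_finiteDimensional) ?_
    refine (isBounded_closedBall (x := (0 : Euc d)) (r := K * ρ)).subset fun t ht => ?_
    rw [Set.mem_preimage, mem_closedBall_zero_iff] at ht
    rw [mem_closedBall_zero_iff]
    have h1 : 1 * ‖t‖ ≤ c ^ n * ‖t‖ := by
      gcongr
      exact one_le_pow₀ hc.le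
    have h2 : K * ‖(Q ^ n) t‖ ≤ K * ρ := by gcongr
    linarith [h n t]
  have hcl : IsClosed ((interior (A i))ᶜ + -((Q ^ n) ⁻¹' closedBall 0 ρ)) :=
    isOpen_interior.isClosed_compl.add_right_of_isCompact hcpt.neg
  convert! hcl.isOpen_compl using 1
  ext s
  simp only [tileCore, Set.mem_ofPred_eq, Set.mem_compl_iff, Set.mem_add, Set.mem_neg,
    Set.mem_preimage, mem_closedBall_zero_iff]
  constructor
  · rintro h ⟨y, hy, t, ht, rfl⟩
    have := h (-t) ht
    rw [add_neg_cancel_right] at this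
    exact hy this
  · intro h t ht
    by_contra hcon
    exact h ⟨s + t, hcon, -t, by rwa [neg_neg], by rw [add_neg_cancel_right]⟩

/-- Points outside the core lie in collars of (int A_i)ᶜ whose width tends to 0; within A_i these
shrink to the boundary, a null set. -/
theorem tendsto_volume_diff_tileCore (hsub : IsSubstitution Q D Λ) (hrep : IsRepresentedBy Q D Λ A)
    (ρ : ℝ) (i : Fin κ) :
    Tendsto (fun n => volume (A i \ tileCore Q A ρ n i)) atTop (𝓝 0) := by
  have hfin : IsFiniteMeasure (volume.restrict (A i)) :=
    isFiniteMeasure_restrict.2 (hrep.adjoint.isCompact i).measure_ne_top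
  have hmeas := (hrep.adjoint.isCompact i).isClosed.measurableSet
  have hlim := tendsto_measure_cthickening_of_isClosed (μ := volume.restrict (A i))
    (s := (interior (A i))ᶜ) ⟨1, one_pos, measure_ne_top _ _⟩ isOpen_interior.isClosed_compl
  have h0 : volume.restrict (A i) (interior (A i))ᶜ = 0 := by
    rw [Measure.restrict_apply' hmeas, Set.inter_comm, ← Set.sdiff_eq]
    exact volume_diff_interior hsub hrep i
  rw [h0] at hlim
  rw [ENNReal.tendsto_atTop_zero]
  intro ε hε
  have hev : ∀ᶠ η in 𝓝[>] (0 : ℝ),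
      volume.restrict (A i) (cthickening η (interior (A i))ᶜ) ≤ ε :=
    ((hlim.eventually_lt_const hε).filter_mono nhdsWithin_le_nhds).mono fun _ h => h.le
  obtain ⟨η, hη, hη0⟩ := (hev.and self_mem_nhdsWithin).exists
  obtain ⟨n₀, hn₀⟩ := hsub.expansive.exists_norm_le ρ hη0
  refine ⟨n₀, fun n hn => le_trans ?_ hη⟩
  rw [Measure.restrict_apply' hmeas]
  refine measure_mono fun s hs => ⟨?_, hs.1⟩
  have hs2 : ¬ ∀ t, ‖(Q ^ n) t‖ ≤ ρ → s + t ∈ interior (A i) := hs.2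
  push Not at hs2
  obtain ⟨t, ht, hst⟩ := hs2
  refine mem_cthickening_of_dist_le s (s + t) η _ hst ?_
  rw [dist_self_add_right]
  exact hn₀ n hn t ht

/-- Upper bound for the occurrences in a region of fixed size at level `n`. -/
theorem exists_volume_le_sum (hrep : IsRepresentedBy Q D Λ A) (r : ℝ) :
    ∃ N : ℕ, 0 < N ∧ ∀ (O : Set (Euc d)) (ρ : ℝ), IsCoreInvariant Q A Λ O ρ → ∀ n h,
      volume (closedBall 0 r ∩ {s | (Q ^ n) (s + h) ∈ O}) ≤
        ∑ j, N * (volume (coreVisits Q A Λ O ρ n j) + volume (A j \ tileCore Q A ρ n j)) := by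
  obtain ⟨ρ₀, hρ₀, hA⟩ := hrep.adjoint.exists_norm_le
  have hN : ∀ j, ∃ N : ℕ, ∀ h, (Λ.pts j ∩ closedBall h (r + ρ₀)).Finite ∧
      (Λ.pts j ∩ closedBall h (r + ρ₀)).ncard ≤ N := by
    intro j
    obtain ⟨e, he, hsep⟩ := (Λ.delone j).exists_le_dist
    exact exists_card_le_of_pairwise_le_dist he hsep _
  choose N hN using hN
  obtain ⟨M, hM⟩ := Finite.exists_le N
  refine ⟨M + 1, Nat.succ_pos M, fun O ρ hO n h => ?_⟩
  have hfin := fun j => (hN j h).1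
  -- Scaled back by Q^n, supertiles are the tiles x + A_j, so the number meeting the region does not
  -- depend on n. Points outside a core are charged to the error term.
  have hcov : closedBall 0 r ∩ {s | (Q ^ n) (s + h) ∈ O} ⊆
      ⋃ j ∈ (Finset.univ : Finset (Fin κ)), ⋃ x ∈ (hfin j).toFinset, (fun s => s + (h - x)) ⁻¹'
        (coreVisits Q A Λ O ρ n j ∪ A j \ tileCore Q A ρ n j) := by
    rintro s ⟨hs, hsO⟩
    obtain ⟨j, x, hx, hxA⟩ := hrep.exists_sub_mem (s + h)
    have hxF : x ∈ (hfin j).toFinset := by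
      rw [Set.Finite.mem_toFinset]
      refine ⟨hx, ?_⟩
      rw [mem_closedBall, dist_eq_norm, ← norm_neg]
      rw [mem_closedBall_zero_iff] at hs
      calc ‖-(x - h)‖ = ‖(s + h - x) - s‖ := by congr 1; abel
        _ ≤ ‖s + h - x‖ + ‖s‖ := norm_sub_le _ _
        _ ≤ r + ρ₀ := by linarith [hA j _ hxA]
    simp only [Set.mem_iUnion]
    refine ⟨j, Finset.mem_univ j, x, hxF, ?_⟩
    rw [Set.mem_preimage, ← add_sub_assoc]
    by_cases hcore : s + h - x ∈ tileCore Q A ρ n j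
    · refine Or.inl ⟨hcore, fun x' hx' => hO n j _ hcore x hx x' hx' ?_⟩
      rw [add_sub_cancel]
      exact hsO
    · exact Or.inr ⟨hxA, hcore⟩
  refine (measure_mono hcov).trans ((measure_biUnion_finset_le _ _).trans ?_)
  refine Finset.sum_le_sum fun j _ => (measure_biUnion_finset_le _ _).trans ?_
  have hcard : (hfin j).toFinset.card ≤ M + 1 := by
    rw [← Set.ncard_eq_toFinset_card _ (hfin j)]
    exact ((hN j h).2.trans (hM j)).trans (Nat.le_succ M)
  calc _ ≤ ∑ x ∈ (hfin j).toFinset,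
        (volume (coreVisits Q A Λ O ρ n j) + volume (A j \ tileCore Q A ρ n j)) := by
        refine Finset.sum_le_sum fun x _ => ?_
        rw [measure_preimage_add_right]
        exact measure_union_le _ _
    _ ≤ _ := by
        rw [Finset.sum_const, nsmul_eq_mul]
        gcongr

/-- A supertile of type `j` at level `n + l` contains one of type `i` at level `n`. -/
theorem volume_coreVisits_le (hsub : IsSubstitution Q D Λ) (hrep : IsRepresentedBy Q D Λ A)
    (n : ℕ) {l : ℕ} {i j : Fin κ}
    (hne : (iterDigits Q D l i j).Nonempty) :
    volume (coreVisits Q A Λ O ρ n i) ≤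
      ENNReal.ofReal |LinearMap.det (Q ^ l)| * volume (coreVisits Q A Λ O ρ (n + l) j) := by
  obtain ⟨u, hu⟩ := hne
  rw [← Measure.addHaar_image_linearMap,
    ← measure_preimage_add_right volume u ((Q ^ l) '' coreVisits Q A Λ O ρ (n + l) j)]
  refine measure_mono fun s hs => ?_
  -- This s' is the position of s in the larger supertile: Q^(n+l) (x + s') = Q^n (Q^l x + u + s),
  -- with Q^l x + u in Λ_i.
  obtain ⟨s', hs'⟩ := hsub.expansive.surjective_pow l (s + u)
  refine ⟨s', ⟨fun t ht => ?_, fun x hx => ?_⟩, hs'⟩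
  · refine mem_interior_of_iterDigits hrep.adjoint (hsub.expansive.injective_pow l) hu ?_
    have := hs.1 ((Q ^ l) t) (by rwa [pow_add, Module.End.mul_apply] at ht)
    convert! this using 1
    rw [map_add, hs']
    abel
  · have := hs.2 ((Q ^ l) x + u) ((hsub.mem_pts_iff l i _).2 ⟨j, x, hx, u, hu, rfl⟩)
    rw [pow_add, Module.End.mul_apply, map_add _ x, hs']
    convert! this using 2
    abel

/-- A legal return vector `z` forces returns by `Q^n z` in every region of fixed size at level
`n + k`. -/
theorem volume_setOf_not_return_le (hsub : IsSubstitution Q D Λ) (hrep : IsRepresentedBy Q D Λ A)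
    {r : ℝ} (htile : ∀ i c, ∃ x ∈ Λ.pts i, ∀ a ∈ A i, x + a ∈ closedBall c r) (hρ : 0 ≤ ρ)
    {m : ℕ} {Δ : Set ((Fin d → ℤ) × Fin κ)} (hΔ : Δ ⊆ colouredCubes d κ m)
    (hO : IsCoreInvariant Q A Λ (visitSet Λ (gridCylinder Λ m Δ)) ρ)
    {k : ℕ} {i j : Fin κ} {u z : Euc d}
    (hu : u ∈ iterDigits Q D k i j) (huz : u + z ∈ iterDigits Q D k i j) (n : ℕ) :
    ENNReal.ofReal |(LinearMap.det (Q ^ k))⁻¹| *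
        volume (coreVisits Q A Λ (visitSet Λ (gridCylinder Λ m Δ)) ρ n i) ≤
      volume (closedBall (0 : Euc d) r) ∧
    ∀ h, volume (closedBall 0 r ∩ {s | ¬ ((Q ^ (n + k)) (s + h) ∈ visitSet Λ (gridCylinder Λ m Δ) ∧
        (Q ^ (n + k)) (s + h) + (Q ^ n) z ∈ visitSet Λ (gridCylinder Λ m Δ))}) ≤
      volume (closedBall (0 : Euc d) r) - ENNReal.ofReal |(LinearMap.det (Q ^ k))⁻¹| *
        volume (coreVisits Q A Λ (visitSet Λ (gridCylinder Λ m Δ)) ρ n i) := by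
  set O := visitSet Λ (gridCylinder Λ m Δ) with hOdef
  set H := coreVisits Q A Λ O ρ n i with hH
  -- The first claim does not involve h; quantifying it vacuously lets one tile of type j near h
  -- serve both claims.
  rw [← forall_const (Euc d) (b := _ ≤ _), ← forall_and]
  intro h
  obtain ⟨x, hx, hxr⟩ := htile j h
  obtain ⟨x₀, hx₀⟩ := Λ.pts_nonempty i
  -- The s for which s + h falls in the piece u + A_i of the subdivided tile x + A_j, at a place
  -- where the pattern is shown.
  let S : Set (Euc d) := (fun s => s + (h - x)) ⁻¹' ((Q ^ k) ⁻¹' ((fun s => s + -u) ⁻¹' H))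
  have hvol : volume S = ENNReal.ofReal |(LinearMap.det (Q ^ k))⁻¹| * volume H := by
    rw [measure_preimage_add_right,
      Measure.addHaar_preimage_linearMap volume (hsub.expansive.det_pow_ne_zero k),
      measure_preimage_add_right]
  -- Core invariance reduces the condition over all points of Λ_i to the single x₀, which makes S
  -- visibly null measurable.
  have hSeq : S = {s | (Q ^ k) (s + (h - x)) + -u ∈ tileCore Q A ρ n i} ∩
      {s | (Q ^ (n + k)) s + (Q ^ n) (x₀ + ((Q ^ k) (h - x) + -u)) ∈ O} := by
    ext s
    have e : (Q ^ (n + k)) s + (Q ^ n) (x₀ + ((Q ^ k) (h - x) + -u)) =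
        (Q ^ n) (x₀ + ((Q ^ k) (s + (h - x)) + -u)) := by
      rw [pow_add, Module.End.mul_apply, ← map_add, map_add _ s]
      congr 1
      abel
    constructor
    · intro hs
      refine ⟨hs.1, ?_⟩
      rw [Set.mem_ofPred_eq, e]
      exact hs.2 x₀ hx₀
    · rintro ⟨hs1, hs2⟩
      rw [Set.mem_ofPred_eq, e] at hs2
      exact ⟨hs1, fun x' hx' => hO n i _ hs1 x₀ hx₀ x' hx' hs2⟩
  have hmeas : NullMeasurableSet S volume := by
    rw [hSeq]
    refine NullMeasurableSet.inter (IsOpen.nullMeasurableSet ?_)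
      (nullMeasurableSet_visitSet hΔ (hsub.expansive.surjective_pow _) _)
    refine (isOpen_tileCore hsub.expansive n i).preimage ?_
    exact ((Q ^ k).continuous_of_finiteDimensional.comp
      (continuous_id.add continuous_const)).add continuous_const
  have hsubset : S ⊆ closedBall 0 r := by
    intro s hs
    have hcore := tileCore_subset hρ n i hs.1
    obtain ⟨a, ha, hae⟩ := (hrep.adjoint.exists_image_iff k j ((Q ^ k) (s + (h - x)))).2
      ⟨i, u, hu, _, hcore, by simp only [add_neg_cancel_comm_assoc]⟩
    have hae' := hsub.expansive.injective_pow k hae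
    have := hxr a ha
    rw [mem_closedBall, dist_eq_norm, ← hae'] at this
    rw [mem_closedBall_zero_iff]
    convert! this using 2
    abel
  rw [← hvol]
  refine ⟨measure_mono hsubset, ?_⟩
  rw [← measure_sdiff hsubset hmeas
    ((measure_mono hsubset).trans_lt measure_closedBall_lt_top).ne]
  refine measure_mono fun s hs => ⟨hs.1, fun hsS => hs.2 ?_⟩
  -- For v = 0 and v = z this is the same core point, read in the two supertiles at Q^k x + u and
  -- Q^k x + u + z.
  have e : ∀ v : Euc d, (Q ^ (n + k)) (s + h) + (Q ^ n) v =
      (Q ^ n) (((Q ^ k) x + (u + v)) + ((Q ^ k) (s + (h - x)) + -u)) := by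
    intro v
    rw [pow_add, Module.End.mul_apply, ← map_add]
    congr 1
    rw [← add_sub_assoc, map_sub]
    abel
  constructor
  · have := hsS.2 _ ((hsub.mem_pts_iff k i _).2 ⟨j, x, hx, u, hu, rfl⟩)
    have e0 := e 0
    rw [map_zero, add_zero, add_zero] at e0
    rw [e0]
    exact this
  · rw [e z]
    exact hsS.2 _ ((hsub.mem_pts_iff k i _).2 ⟨j, x, hx, u + z, huz, rfl⟩)

end Estimates

/-! ### Returns of cylinder sets -/

section Returns

variable {Q : Euc d →ₗ[ℝ] Euc d} {D : Fin κ → Fin κ → Finset (Euc d)}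
  {Λ : DeloneKSet d κ} {A : Fin κ → Set (Euc d)}
  {μ : Measure (hull Λ)} [IsProbabilityMeasure μ]
  {m : ℕ} {Δ : Set ((Fin d → ℤ) × Fin κ)}

theorem hullTranslate_neg_image (Λ : DeloneKSet d κ) (w : Euc d) (E : Set (hull Λ)) :
    hullTranslate Λ (-w) '' E = hullTranslate Λ w ⁻¹' E := by
  have h0 : ∀ Γ, hullTranslate Λ 0 Γ = Γ := fun Γ => Subtype.ext (translate_zero Γ.1)
  ext Γ
  constructor
  · rintro ⟨Γ', h, rfl⟩
    rwa [Set.mem_preimage, hullTranslate_hullTranslate, add_neg_cancel, h0]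
  · intro h
    exact ⟨_, h, by rw [hullTranslate_hullTranslate, neg_add_cancel, h0]⟩

theorem measure_gridCylinder_mul_le
    (hμ : ∀ g : Euc d, MeasurePreserving (hullTranslate Λ g) μ μ)
    (hΔ : Δ ⊆ colouredCubes d κ m) {f : Euc d →ₗ[ℝ] Euc d} (hf : Function.Surjective f)
    {W : Set (Euc d)} (hW : MeasurableSet W) {b : ENNReal}
    (hb : ∀ h, volume (W ∩ {s | f (s + h) ∈ visitSet Λ (gridCylinder Λ m Δ)}) ≤ b) :
    μ (gridCylinder Λ m Δ) * volume W ≤ b := by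
  rw [← measure_congr (interior_ae_eq_of_null_frontier (measure_frontier_gridCylinder hμ hΔ))]
  refine measure_mul_volume_le hμ hf isOpen_interior hW fun h => le_trans (measure_mono ?_) (hb h)
  exact Set.inter_subset_inter_right _ fun s hs =>
    interior_subset (s := gridCylinder Λ m Δ) hs

/-- The complement of the closure of the return set is open, so the upper estimate applies to it;
the closure adds nothing because the frontiers of the cylinder and of its translate are null. -/
theorem one_sub_measure_return_mul_le
    (hμ : ∀ g : Euc d, MeasurePreserving (hullTranslate Λ g) μ μ)
    (hΔ : Δ ⊆ colouredCubes d κ m) {f : Euc d →ₗ[ℝ] Euc d} (hf : Function.Surjective f)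
    (w : Euc d) {W : Set (Euc d)} (hW : MeasurableSet W) {b : ENNReal}
    (hb : ∀ h, volume (W ∩ {s | ¬ (f (s + h) ∈ visitSet Λ (gridCylinder Λ m Δ) ∧
      f (s + h) + w ∈ visitSet Λ (gridCylinder Λ m Δ))}) ≤ b) :
    (1 - μ (gridCylinder Λ m Δ ∩ hullTranslate Λ (-w) '' gridCylinder Λ m Δ)) * volume W ≤ b := by
  set E := gridCylinder Λ m Δ
  rw [hullTranslate_neg_image]
  have hfr := measure_frontier_gridCylinder hμ hΔ
  have hfr' : μ (frontier (E ∩ hullTranslate Λ w ⁻¹' E)) = 0 := by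
    have hpre : μ (hullTranslate Λ w ⁻¹' frontier E) = 0 := by
      rw [(hμ w).measure_preimage isClosed_frontier.measurableSet.nullMeasurableSet]
      exact hfr
    refine measure_mono_null ((frontier_inter_subset _ _).trans (Set.union_subset_union
      Set.inter_subset_left (Set.inter_subset_right.trans
        ((continuous_hullTranslate Λ w).frontier_preimage_subset E)))) ?_
    exact measure_union_null hfr hpre
  rw [← measure_congr (closure_ae_eq_of_null_frontier hfr'),
    ← prob_compl_eq_one_sub isClosed_closure.measurableSet]
  refine measure_mul_volume_le hμ hf isClosed_closure.isOpen_compl hW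
    fun h => le_trans (measure_mono ?_) (hb h)
  refine Set.inter_subset_inter_right _ fun s hs hret => hs (subset_closure ⟨hret.1, ?_⟩)
  rw [Set.mem_preimage, hullTranslate_hullTranslate, add_comm]
  exact hret.2

end Returns

end SubstDelone

/-! ### Comparison of occurrences with returns -/

open SubstDelone
theorem mainTheorem12 (d κ : ℕ)
    (Q : Euc d →ₗ[ℝ] Euc d) (D : Fin κ → Fin κ → Finset (Euc d))
    (Λ : DeloneKSet d κ) (A : Fin κ → Set (Euc d))
    (hsub : IsSubstitution Q D Λ) (hprim : IsPrimitive D) (hrep : IsRepresentedBy Q D Λ A)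
    (z : Euc d) (hz : z ∈ legalReturnVectors Q D Λ A) :
    ∃ δ : ℝ, 0 < δ ∧
      ∀ μ : Measure (hull Λ), IsProbabilityMeasure μ →
        (∀ g : Euc d, MeasurePreserving (hullTranslate Λ g) μ μ) →
        ∀ m₀ : ℕ, IsAdmissibleScale Λ m₀ →
          ∀ m : ℕ, m₀ ≤ m → ∀ Δ : Set ((Fin d → ℤ) × Fin κ), IsCubeChoice m Δ →
            0 < μ.real (gridCylinder Λ m Δ) →
            ∃ n₀ : ℕ, ∀ n : ℕ, n₀ ≤ n →
              δ * μ.real (gridCylinder Λ m Δ) <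
                μ.real (gridCylinder Λ m Δ ∩
                  hullTranslate Λ (-((Q ^ n) z)) '' gridCylinder Λ m Δ) := by
  obtain ⟨k, i, j, u, hu, huz⟩ := exists_iterDigits_of_mem_legalReturnVectors hrep.adjoint hz
  obtain ⟨l, -, hl⟩ := hprim
  obtain ⟨r, hr, htile⟩ := hrep.adjoint.exists_tile_subset_ball Λ
  obtain ⟨N, hN, hupper⟩ := exists_volume_le_sum hrep r
  have hκ : (0 : ℝ) < κ := by exact_mod_cast i.pos
  have hNr : (0 : ℝ) < N := by exact_mod_cast hN
  set p := |(LinearMap.det (Q ^ k))⁻¹| with hp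
  have hp0 : 0 < p := abs_pos.2 (inv_ne_zero (hsub.expansive.det_pow_ne_zero k))
  set q := |LinearMap.det (Q ^ l)| with hq
  have hq0 : 0 < q := abs_pos.2 (hsub.expansive.det_pow_ne_zero l)
  -- All of p, q, N, κ are fixed before μ and the cylinder. Absorbing the boundary error costs a
  -- factor 2; the 4 leaves slack.
  refine ⟨p / (4 * κ * N * q), by positivity, fun μ hprob hμ m₀ _ m _ Δ hΔ hpos => ?_⟩
  obtain ⟨ρ, hρ, hO⟩ := exists_isCoreInvariant hsub hrep m Δ
  set E := gridCylinder Λ m Δ with hE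
  set V := volume (closedBall (0 : Euc d) r) with hV
  have hV0 : 0 < V.toReal :=
    ENNReal.toReal_pos (measure_closedBall_pos volume _ hr).ne' measure_closedBall_lt_top.ne
  have hVtop : V ≠ ⊤ := measure_closedBall_lt_top.ne
  have herr : Filter.Tendsto (fun n => (∑ j, volume (A j \ tileCore Q A ρ n j)).toReal)
      Filter.atTop (nhds 0) := by
    have := tendsto_finsetSum (Finset.univ : Finset (Fin κ))
      fun j _ => tendsto_volume_diff_tileCore hsub hrep ρ j
    rw [Finset.sum_const_zero] at this
    exact (ENNReal.tendsto_toReal ENNReal.zero_ne_top).comp this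
  -- Beyond this threshold N times the error is less than half of μ(E) V; positivity of μ(E) is
  -- needed here.
  obtain ⟨n₁, hn₁⟩ := Filter.eventually_atTop.1
    (herr.eventually_lt_const (by positivity : 0 < μ.real E * V.toReal / (2 * N)))
  refine ⟨n₁ + l, fun n' hn' => ?_⟩
  -- The given exponent is n + l: occurrences are counted in supertiles of level n, moved by
  -- primitivity into type i at level n + l, and returned there by Q^(n+l) z.
  obtain ⟨n, rfl⟩ := Nat.exists_eq_add_of_le' (le_of_add_le_right hn')
  specialize hn₁ n (by omega)
  set X := volume (coreVisits Q A Λ (visitSet Λ E) ρ (n + l) i) with hX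
  set Err := ∑ j, volume (A j \ tileCore Q A ρ n j) with hErr
  have hcorele : ∀ n j, volume (coreVisits Q A Λ (visitSet Λ E) ρ n j) ≠ ⊤ := fun n j =>
    ((measure_mono fun s hs => tileCore_subset hρ.le n j hs.1).trans_lt
      (hrep.adjoint.isCompact j).measure_lt_top).ne
  have hXtop : X ≠ ⊤ := hcorele _ _
  have hErrtop : Err ≠ ⊤ := ENNReal.sum_ne_top.2 fun j _ =>
    ((measure_mono Set.sdiff_subset).trans_lt (hrep.adjoint.isCompact j).measure_lt_top).ne
  have h1 : μ E * V ≤ N * (κ * (ENNReal.ofReal q * X) + Err) := by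
    refine measure_gridCylinder_mul_le hμ hΔ.1 (hsub.expansive.surjective_pow n)
      isClosed_closedBall.measurableSet fun h => (hupper _ ρ hO n h).trans ?_
    rw [← Finset.mul_sum, Finset.sum_add_distrib]
    gcongr
    calc _ ≤ ∑ _j : Fin κ, ENNReal.ofReal q * X := Finset.sum_le_sum fun j _ =>
          volume_coreVisits_le hsub hrep n (iterDigits_nonempty l j i (hl j i))
      _ = _ := by simp
  obtain ⟨hle, hbad⟩ := volume_setOf_not_return_le hsub hrep htile hρ.le hΔ.1 hO hu huz (n + l)
  have h2 := one_sub_measure_return_mul_le hμ hΔ.1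
    (hsub.expansive.surjective_pow (n + l + k)) _ isClosed_closedBall.measurableSet hbad
  set E' := E ∩ hullTranslate Λ (-((Q ^ (n + l)) z)) '' E with hE'
  have h1r : μ.real E * V.toReal ≤ N * (κ * (q * X.toReal) + Err.toReal) := by
    have := ENNReal.toReal_mono (by finiteness) h1
    rw [ENNReal.toReal_mul, ENNReal.toReal_mul, ENNReal.toReal_add (by finiteness) hErrtop,
      ENNReal.toReal_mul, ENNReal.toReal_mul, ENNReal.toReal_ofReal hq0.le] at this
    simpa [Measure.real] using this
  have h2r : (1 - μ.real E') * V.toReal ≤ V.toReal - p * X.toReal := by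
    have := ENNReal.toReal_mono (by finiteness) h2
    rw [ENNReal.toReal_mul, ENNReal.toReal_sub_of_le prob_le_one ENNReal.one_ne_top,
      ENNReal.toReal_sub_of_le hle hVtop, ENNReal.toReal_mul, ENNReal.toReal_ofReal hp0.le] at this
    simpa [Measure.real] using this
  have h3 : μ.real E * V.toReal / 2 < N * κ * q * X.toReal := by
    rw [lt_div_iff₀ (by positivity)] at hn₁
    linarith
  have h4 : p * X.toReal ≤ μ.real E' * V.toReal := by linarith
  rw [div_mul_eq_mul_div, div_lt_iff₀ (by positivity)]
  refine lt_of_mul_lt_mul_right ?_ hV0.le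
  have h5 : p * (μ.real E * V.toReal / 2) < p * (N * κ * q * X.toReal) := by gcongr
  have h6 : κ * N * q * (p * X.toReal) ≤ κ * N * q * (μ.real E' * V.toReal) := by gcongr
  have h7 : 0 ≤ p * (μ.real E * V.toReal) := by positivity
  linarith
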